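/- Let $K\ge 2$, $\xi_1,\xi_2>0$, $\alpha\in(0,1)$, $\beta:=1-\alpha$, $q_m\in(0,1)$, $q_c\in(0,1/2)$. For a real random variable $X$ with CDF $F_X$ put $v_\alpha(X)=\inf\{t: F_X(t)\ge\alpha\}$ and $c_\alpha(X)=v_\alpha(X)+\frac1{1-\alpha}\mathbb E[(X-v_\alpha(X))^+]$. There are $K$ arms; the loss of arm $i$ is distributed as $X(i)$. Assume that every $X(i)$ has a continuous CDF that is strictly increasing over the support of $X(i)$, and that there are $p>1$ and $B<\infty$ with $\mathbb E|X(i)|^p<B$ for all $i$, where $B\ge 1$ in case $p>2$. Assume that a unique arm $i^*$ minimizes $\xi_1\mathbb E[X(i)]+\xi_2c_\alpha(X(i))$, and let $\Delta[2]>0$ be the difference between the second smallest and the smallest of these $K$ values. From the first $n$ samples $X^i_1,\dots,X^i_n$ of arm $i$ form $$\hat\mu^\dagger_n(i)=\frac1n\sum_{j=1}^nX^i_j\,\mathbb 1\{|X^i_j|\le n^{q_m}\},\qquad \hat c^\dagger_{n,\alpha}(i)=\frac1{n(1-\alpha)}\sum_{j=1}^nY_j\,\mathbb 1\{Y_j\ge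 Y_{[\lfloor n(1-\alpha)\rfloor]}\},$$ where $Y_j=\min(\max(-n^{q_c},X^i_j),n^{q_c})$ and $Y_{[1]}\ge\dots\ge Y_{[n]}$ are the order statistics. Given a budget of $T$ pulls, uniform exploration is the successive rejects algorithm with $K-1$ phases in which every arm is pulled $n=\lfloor T/K\rfloor$ times in total (all in the first phase) and at the end of each phase an arm with the largest value of $\xi_1\hat\mu^\dagger_n(i)+\xi_2\hat c^\dagger_{n,\alpha}(i)$ among the remaining arms is rejected, ties being broken in any way; the last remaining arm is the output. All samples are independent. Let $p_e$ be the probability that the output is not $i^*$, and let $$n^*=\max\Big(\Big(\tfrac{12\xi_1B}{\Delta[2]}\Big)^{\frac1{q_m\min(p-1,1)}},\Big(\tfrac{8\xi_2B}{\beta\Delta[2]}\Big)^{\frac1{q_c(p-1)}},\Big(\tfrac{B}{\min(\alpha,\beta)}\Big)^{\frac1{q_cp}},\Big(\tfrac{\Delta[2]}{8\xi_2}\Big)^{\frac1{q_c}}\Big).$$ If $\lfloor T/K\rfloor>n^*$, then $$p_e\le 2K\exp\Big(-(T/K)^{1-q_m}\frac{\Delta[2]}{16\xi_1}\Big)+6K\exp\Big(-(T/K)^{1-2q_c}\frac{\beta\,\Delta[2]^2}{768\,\xi_2^2}\Big).$$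 -/

import Mathlib

open MeasureTheory ProbabilityTheory

noncomputable section

namespace RiskBandit

/-! ### Risk measures and conditions on a loss distribution -/

/-- Value at Risk of the law `ν` at level `α`: the smallest `t` with `F(t) ≥ α`, i.e. the
`α`-quantile (it equals `F⁻¹(α)` when the CDF `F` is continuous and strictly increasing). -/
def valueAtRisk (α : ℝ) (ν : Measure ℝ) : ℝ :=
  sInf {t : ℝ | α ≤ cdf ν t}

/-- Conditional Value at Risk: `v_α + (1-α)⁻¹ E[(X - v_α)⁺]`. -/
def cvar (α : ℝ) (ν : Measure ℝ) : ℝ :=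
  valueAtRisk α ν + 1 / (1 - α) * ∫ x, max 0 (x - valueAtRisk α ν) ∂ν

/-- Condition C1: continuous, with a CDF that is strictly increasing over the support. -/
def CondC1 (ν : Measure ℝ) : Prop :=
  Continuous (cdf ν) ∧ StrictMonoOn (cdf ν) ν.support

/-- Condition C2 with exponent `p` and bound `B`: the `p`-th absolute moment exists and is
smaller than `B`. -/
def CondC2 (p B : ℝ) (ν : Measure ℝ) : Prop :=
  Integrable (fun x => |x| ^ p) ν ∧ ∫ x, |x| ^ p ∂ν < B

/-! ### Estimators -/

/-- The `i`-th largest value (`i = 1` is the largest) among `x₀, …, xₙ₋₁`;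
`0` if `i` is not in `{1, …, n}`. -/
def orderStat {n : ℕ} (x : Fin n → ℝ) (i : ℕ) : ℝ :=
  if h : 1 ≤ i ∧ i ≤ n then x (Tuple.sort (fun j => -x j) ⟨i - 1, by omega⟩) else 0

/-- Empirical VaR: the `⌊n(1-α)⌋`-th largest sample. -/
def empVaR (α : ℝ) {n : ℕ} (x : Fin n → ℝ) : ℝ :=
  orderStat x ⌊(n : ℝ) * (1 - α)⌋₊

/-- Empirical CVaR: `(n(1-α))⁻¹ ∑ xᵢ 1{xᵢ ≥ v̂}`. -/
def empCVaR (α : ℝ) {n : ℕ} (x : Fin n → ℝ) : ℝ :=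
  1 / ((n : ℝ) * (1 - α)) * ∑ i, if empVaR α x ≤ x i then x i else 0

/-- Projection of `x` onto `[-b, b]`. -/
def clip (b x : ℝ) : ℝ := min (max (-b) x) b

/-- The CVaR estimator applied to the samples projected onto `[-b, b]`. -/
def clippedCVaR (α b : ℝ) {n : ℕ} (x : Fin n → ℝ) : ℝ :=
  empCVaR α (fun i => clip b (x i))

/-- Truncated empirical mean: samples with `|xⱼ| > b` are replaced by `0`. -/
def truncMean (b : ℝ) {n : ℕ} (x : Fin n → ℝ) : ℝ :=
  (∑ j, if |x j| ≤ b then x j else 0) / (n : ℝ)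

/-- Estimated performance of an arm from its first `n` samples, with truncation levels
`n ^ qm` for the mean and `n ^ qc` for the CVaR. -/
def armEstimate (ξ₁ ξ₂ α qm qc : ℝ) (x : ℕ → ℝ) (n : ℕ) : ℝ :=
  ξ₁ * truncMean ((n : ℝ) ^ qm) (fun j : Fin n => x j) +
    ξ₂ * clippedCVaR α ((n : ℝ) ^ qc) (fun j : Fin n => x j)

/-! ### Arms and algorithm -/

/-- The true performance metric `ξ₁ E[X] + ξ₂ c_α(X)` of an arm with law `ν`. -/
def objective (ξ₁ ξ₂ α : ℝ) (ν : Measure ℝ) : ℝ :=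
  ξ₁ * (∫ x, x ∂ν) + ξ₂ * cvar α ν

/-- The smallest suboptimality gap `Δ[2]`, relative to the arm `iStar`. -/
def minGap {K : ℕ} (ξ₁ ξ₂ α : ℝ) (ν : Fin K → Measure ℝ) (iStar : Fin K) : ℝ :=
  ⨅ i : {i : Fin K // i ≠ iStar}, (objective ξ₁ ξ₂ α (ν i) - objective ξ₁ ξ₂ α (ν iStar))

/-- `out` is a possible output of the generalized successive rejects algorithm with phase
lengths `n₁ ≤ … ≤ n_{K-1}`: all arms are active at first, and at the end of phase `k`, when each
active arm has been pulled `n k` times in total, an active arm whose estimate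
`est i (n k)` is the largest among the active arms is rejected (ties broken in any way). The
arm left after phase `K - 1` is the output. Here `est i m` is the estimate for arm `i`
computed from its first `m` samples. -/
def IsGSROutput {K : ℕ} (n : ℕ → ℕ) (est : Fin K → ℕ → ℝ) (out : Fin K) : Prop :=
  ∃ A : ℕ → Finset (Fin K),
    A 1 = Finset.univ ∧
    (∀ k, 1 ≤ k → k ≤ K - 1 →
      ∃ a ∈ A k, (∀ i ∈ A k, est i (n k) ≤ est a (n k)) ∧ A (k + 1) = (A k).erase a) ∧
    A K = {out}

/-- Uniform exploration with budget `T`: the special case `n₁ = … = n_{K-1} = ⌊T/K⌋`. -/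
def IsUniformExplorationOutput {K : ℕ} (T : ℕ) (est : Fin K → ℕ → ℝ) (out : Fin K) : Prop :=
  IsGSROutput (fun _ => T / K) est out

/-- The threshold `n*` on the number of samples per arm. -/
def nStar (ξ₁ ξ₂ α qm qc p B Δ : ℝ) : ℝ :=
  max (max ((12 * ξ₁ * B / Δ) ^ (1 / (qm * min (p - 1) 1)))
      ((8 * ξ₂ * B / ((1 - α) * Δ)) ^ (1 / (qc * (p - 1)))))
    (max ((B / min α (1 - α)) ^ (1 / (qc * p)))
      ((Δ / (8 * ξ₂)) ^ (1 / qc)))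

end RiskBandit

end

namespace RiskBandit

/-! ### Order statistics -/

section OrderStat

variable {n : ℕ} {y : Fin n → ℝ} {m : ℕ}

/-! All phases use the same sample size, so the output minimizes the estimate over all arms
(`IsUniformExplorationOutput.le`). A wrong output therefore forces the estimate of `iStar` up by
`Δ/2` or that of the output down by `Δ/2`. Each arm contributes one tail event, and a union bound
over the `K` arms gives the factor `K`. In `armEstimate_tails` the deviation `Δ/2` is split into
`Δ/4` for the mean and `Δ/4` for the CVaR.

Mean: truncation at `b = n^qm` has bias at most `D = Δ/(12ξ₁)` and second moment at most `b * D`. A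
Chernoff bound with parameter `1/b` controls the fluctuation `2 * D`.

CVaR: write `β = 1 - α`, `v` for the value at risk, `b = n^qc`, `θ = Δ/(8ξ₂b)`. The estimator is
nonlinear because its threshold is an order statistic. Deterministic inequalities
(`tailSum_orderStat_le`, `tailSum_orderStat_ge`) replace that threshold by `v`, leaving sums of
i.i.d. terms supported on `[v, ∞)`. Their second moment is at most `4b²β`, hence exponents linear in
`β` (`measureReal_sum_ge_le_of_support`). The replacement can fail only through ties. Continuity of
the CDF excludes ties almost surely except those made by clipping at `b` or `-b`, which are treated
separately.

The bounds are proved with `n = ⌊T/K⌋`. Slack in the prefactors `2` and `6` pays for passing to `T/K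
≤ n + 1`. -/

lemma orderStat_eq (h1 : 1 ≤ m) (hn : m ≤ n) :
    orderStat y m = y (Tuple.sort (fun j => -y j) ⟨m - 1, by omega⟩) := by
  rw [orderStat, dif_pos ⟨h1, hn⟩]

lemma antitone_comp_sort (y : Fin n → ℝ) : Antitone (y ∘ Tuple.sort (fun j => -y j)) := by
  intro i j hij
  have := Tuple.monotone_sort (fun j => -y j) hij
  simpa using this

lemma le_card_orderStat_le (h1 : 1 ≤ m) (hn : m ≤ n) :
    m ≤ (Finset.univ.filter fun j => orderStat y m ≤ y j).card := by
  rw [orderStat_eq h1 hn]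
  set σ := Tuple.sort (fun j => -y j)
  have hc : ((Finset.Iic (⟨m - 1, by omega⟩ : Fin n)).map σ.toEmbedding).card = m := by
    rw [Finset.card_map, Fin.card_Iic]
    simp only
    omega
  calc m = _ := hc.symm
    _ ≤ _ := Finset.card_le_card fun j hj => by
      obtain ⟨i, hi, rfl⟩ := Finset.mem_map.1 hj
      simpa using antitone_comp_sort y (Finset.mem_Iic.1 hi)

lemma card_orderStat_lt_lt (h1 : 1 ≤ m) (hn : m ≤ n) :
    (Finset.univ.filter fun j => orderStat y m < y j).card < m := by
  rw [orderStat_eq h1 hn]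
  set σ := Tuple.sort (fun j => -y j)
  have hc : ((Finset.Iio (⟨m - 1, by omega⟩ : Fin n)).map σ.toEmbedding).card = m - 1 := by
    rw [Finset.card_map, Fin.card_Iio]
  have hle : (Finset.univ.filter fun j => y (σ ⟨m - 1, by omega⟩) < y j).card ≤ m - 1 := by
    refine (Finset.card_le_card fun j hj => ?_).trans hc.le
    simp only [Finset.mem_filter, Finset.mem_univ, true_and] at hj
    refine Finset.mem_map.2 ⟨σ.symm j, Finset.mem_Iio.2 ?_, by simp⟩
    by_contra hcon
    have := antitone_comp_sort y (not_lt.1 hcon)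
    simp only [Function.comp_apply] at this
    have e : σ (σ.symm j) = j := by simp
    change y (σ (σ.symm j)) ≤ y (σ _) at this
    rw [e] at this
    linarith
  omega

lemma exists_orderStat_eq (h1 : 1 ≤ m) (hn : m ≤ n) : ∃ j, orderStat y m = y j :=
  ⟨_, orderStat_eq h1 hn⟩

/-- The estimator sums every sample reaching the empirical quantile, so a tie there would add terms
beyond the top `m`. -/
lemma card_orderStat_le_of_unique (h1 : 1 ≤ m) (hn : m ≤ n)
    (hy : ∀ i j, y i = orderStat y m → y j = orderStat y m → i = j) :
    (Finset.univ.filter fun j => orderStat y m ≤ y j).card = m := by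
  refine le_antisymm ?_ (le_card_orderStat_le h1 hn)
  have hsub : (Finset.univ.filter fun j => orderStat y m ≤ y j) ⊆
      (Finset.univ.filter fun j => orderStat y m < y j) ∪
        (Finset.univ.filter fun j => y j = orderStat y m) := by
    intro j hj
    simp only [Finset.mem_filter, Finset.mem_univ, true_and, Finset.mem_union] at hj ⊢
    rcases hj.lt_or_eq with h | h
    · exact Or.inl h
    · exact Or.inr h.symm
  have h2 : (Finset.univ.filter fun j => y j = orderStat y m).card ≤ 1 :=
    Finset.card_le_one.2 fun i hi j hj => hy i j (by simpa using hi) (by simpa using hj)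
  have := (Finset.card_le_card hsub).trans (Finset.card_union_le _ _)
  have := card_orderStat_lt_lt (y := y) h1 hn
  omega

/-- The sum of the samples that are at least `t`. -/
noncomputable def tailSum (y : Fin n → ℝ) (t : ℝ) : ℝ := ∑ j, if t ≤ y j then y j else 0

/-- The number of samples that are at least `t`. -/
noncomputable def tailCount (y : Fin n → ℝ) (t : ℝ) : ℝ := ∑ j, if t ≤ y j then (1 : ℝ) else 0

lemma tailCount_eq_card (y : Fin n → ℝ) (t : ℝ) :
    tailCount y t = (Finset.univ.filter fun j => t ≤ y j).card := by
  simp [tailCount]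

lemma tailSum_sub (y : Fin n → ℝ) (t s : ℝ) :
    tailSum y t - s * tailCount y t = ∑ j, if t ≤ y j then y j - s else 0 := by
  rw [tailSum, tailCount, Finset.mul_sum, ← Finset.sum_sub_distrib]
  refine Finset.sum_congr rfl fun j _ => ?_
  split_ifs <;> simp

/-- Comparing the tail sum above `t` with the one above another threshold `v`. -/
lemma tailSum_sub_le (y : Fin n → ℝ) (t v : ℝ) :
    tailSum y v - t * tailCount y v ≤ tailSum y t - t * tailCount y t := by
  rw [tailSum_sub, tailSum_sub]
  refine Finset.sum_le_sum fun j _ => ?_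
  split_ifs <;> linarith

/-- Lower bound for the sum of the samples above the empirical quantile, for samples in
`[-b, b]`. -/
lemma tailSum_orderStat_ge {b N v : ℝ} (h1 : 1 ≤ m) (hn : m ≤ n) (hb : ∀ j, |y j| ≤ b)
    (hmN : (m : ℝ) ≤ N) (hNm : N ≤ m + 1)
    (hcard : tailCount y (orderStat y m) = m ∨ 0 ≤ orderStat y m) :
    tailSum y v + b * tailCount y v - N * b ≤ tailSum y (orderStat y m) ∨
      tailSum y v - b * tailCount y v + (N - 1) * b ≤ tailSum y (orderStat y m) := by
  obtain ⟨k, hk⟩ := exists_orderStat_eq (y := y) h1 hn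
  have hc1 : (m : ℝ) ≤ tailCount y (orderStat y m) := by
    rw [tailCount_eq_card]
    exact_mod_cast le_card_orderStat_le h1 hn
  set t := orderStat y m
  have ht : |t| ≤ b := hk ▸ hb k
  obtain ⟨htl, htr⟩ := abs_le.1 ht
  have hcmp := tailSum_sub_le y t v
  -- Extra tied terms, each equal to `t`, do no harm to a lower bound when `t ≥ 0`.
  have hmt : m * t ≤ t * tailCount y t := by
    rcases hcard with h | h
    · rw [h, mul_comm]
    · nlinarith
  -- So far `tailSum y t ≥ tailSum y v + t * (m - tailCount y v)`. Inserting `t ≥ -b` or `t ≤ b`,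
  -- according to the sign of the bracket, removes the random `t`.
  rcases le_total (tailCount y v) m with h | h
  · left
    nlinarith
  · right
    nlinarith

/-- Upper bound for the sum of the samples above the empirical quantile. -/
lemma tailSum_orderStat_le (h1 : 1 ≤ m) (hn : m ≤ n) (v : ℝ)
    (hcard : tailCount y (orderStat y m) = m ∨ orderStat y m ≤ 0) :
    tailSum y (orderStat y m) ≤ tailSum y v - v * tailCount y v + m * v := by
  have hc1 : (m : ℝ) ≤ tailCount y (orderStat y m) := by
    rw [tailCount_eq_card]
    exact_mod_cast le_card_orderStat_le h1 hn
  have hc2 : ((Finset.univ.filter fun j => orderStat y m < y j).card : ℝ) ≤ m := by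
    exact_mod_cast (card_orderStat_lt_lt h1 hn).le
  set t := orderStat y m
  have hmt : t * tailCount y t ≤ m * t := by
    rcases hcard with h | h
    · rw [h, mul_comm]
    · nlinarith
  -- This compares `∑ (y - t)⁺` with `∑ (y - v)⁺`, the empirical form of the variational formula for
  -- CVaR. For `t ≤ v` fewer than `m` samples exceed `t`; for `t ≥ v` at least `m` samples reach
  -- `t`.
  suffices tailSum y t - t * tailCount y t ≤ tailSum y v - v * tailCount y v + m * (v - t) by
    linarith
  rw [tailSum_sub, tailSum_sub]
  rcases le_total t v with htv | htv
  · calc (∑ j, if t ≤ y j then y j - t else 0)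
        ≤ ∑ j, ((if v ≤ y j then y j - v else 0) + if t < y j then v - t else 0) := by
          refine Finset.sum_le_sum fun j _ => ?_
          split_ifs <;> linarith
      _ ≤ _ := by
          rw [Finset.sum_add_distrib, ← Finset.sum_filter _ (fun _ => v - t), Finset.sum_const,
            nsmul_eq_mul]
          nlinarith
  · have : tailCount y t * (t - v) ≤ ∑ j, ((if v ≤ y j then y j - v else 0) -
        if t ≤ y j then y j - t else 0) := by
      rw [tailCount, Finset.sum_mul]
      refine Finset.sum_le_sum fun j _ => ?_
      split_ifs <;> linarith
    rw [Finset.sum_sub_distrib] at this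
    nlinarith

end OrderStat

/-! ### Successive rejects -/

/-- With a fixed estimate per arm, an output of successive rejects minimizes the estimate. -/
lemma IsUniformExplorationOutput.le {K T : ℕ} {est : Fin K → ℕ → ℝ} {out : Fin K}
    (h : IsUniformExplorationOutput T est out) (i : Fin K) :
    est out (T / K) ≤ est i (T / K) := by
  obtain ⟨A, hA1, hstep, hAK⟩ := h
  have hK : 1 ≤ K := Nat.one_le_iff_ne_zero.2 (by rintro rfl; exact out.elim0)
  -- Backward induction on the phases: the arm rejected in phase `k` had the largest estimate while
  -- `out` was still active.
  have key : ∀ d k, k + d = K → 1 ≤ k → out ∈ A k ∧ ∀ j ∈ A k, est out (T / K) ≤ est j (T / K) := by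
    intro d
    induction d with
    | zero =>
      rintro k rfl -
      simp only [add_zero] at hAK
      rw [hAK]
      simp
    | succ d ih =>
      intro k hk h1
      obtain ⟨hmem, hle⟩ := ih (k + 1) (by omega) (by omega)
      obtain ⟨a, ha, hmax, hnext⟩ := hstep k h1 (by omega)
      rw [hnext] at hmem hle
      have hout := Finset.mem_of_mem_erase hmem
      refine ⟨hout, fun j hj => ?_⟩
      by_cases hja : j = a
      · exact hja ▸ hmax out hout
      · exact hle j (Finset.mem_erase.2 ⟨hja, hj⟩)
  exact (key (K - 1) 1 (by omega) le_rfl).2 i (by rw [hA1]; exact Finset.mem_univ i)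

/-! ### Exponential tail bounds -/

/-- For `x ≥ 0` this is Taylor with cubic remainder `2x³/9`. For `x ≤ 0` it follows from `(1 + x +
x²/2) * (1 - x + x²/2) = 1 + x⁴/4`. No lower bound on `x` is needed. -/
lemma exp_le_one_add_add_sq {c x : ℝ} (hc : 0 ≤ c) (hc1 : c ≤ 1) (hx : x ≤ c) :
    Real.exp x ≤ 1 + x + (1 / 2 + 2 * c / 9) * x ^ 2 := by
  rcases le_total 0 x with h0 | h0
  · have h := Real.exp_bound' h0 (hx.trans hc1) (n := 3) (by norm_num)
    norm_num [Finset.sum_range_succ, Nat.factorial] at h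
    nlinarith [mul_le_mul_of_nonneg_right hx (sq_nonneg x)]
  · have h := Real.quadratic_le_exp_of_nonneg (neg_nonneg.2 h0)
    have hpos : 0 < 1 + -x + (-x) ^ 2 / 2 := by nlinarith
    have h1 : Real.exp x ≤ 1 + x + x ^ 2 / 2 := by
      rw [← neg_neg x, Real.exp_neg, neg_neg]
      refine (inv_anti₀ hpos h).trans ?_
      rw [inv_le_comm₀ hpos (by nlinarith [sq_nonneg (1 + x)]), inv_le_iff_one_le_mul₀
        (by nlinarith [sq_nonneg (1 + x)])]
      nlinarith [sq_nonneg (x ^ 2)]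
    nlinarith [mul_nonneg hc (sq_nonneg x)]

section Tail

variable {Ω : Type*} [MeasurableSpace Ω] {μ : Measure Ω} [IsProbabilityMeasure μ]
  {ν : Measure ℝ} [IsProbabilityMeasure ν] {X : ℕ → Ω → ℝ}

lemma integrable_of_abs_le {f : ℝ → ℝ} (hf : Measurable f) {C : ℝ} (hC : ∀ x, |f x| ≤ C) :
    Integrable f ν :=
  Integrable.of_bound hf.aestronglyMeasurable C (Filter.Eventually.of_forall hC)

/-- Exponential Chebyshev bound for a sum of i.i.d. bounded variables, in terms of a bound `V`
on the second moment. -/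
lemma measureReal_sum_ge_le_exp (hlaw : ∀ j, HasLaw (X j) ν μ) (hind : iIndepFun X μ)
    {f : ℝ → ℝ} (hf : Measurable f) {C : ℝ} (hC : ∀ x, |f x| ≤ C) {l c V : ℝ} (hl : 0 ≤ l)
    (hc : 0 ≤ c) (hc1 : c ≤ 1) (hlf : ∀ x, l * f x ≤ c) (hV : ∫ x, f x ^ 2 ∂ν ≤ V)
    (n : ℕ) (s : ℝ) :
    μ.real {ω | n * (∫ x, f x ∂ν) + s ≤ ∑ j : Fin n, f (X j ω)} ≤
      Real.exp (-(l * s) + n * ((1 / 2 + 2 * c / 9) * l ^ 2 * V)) := by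
  set e := ∫ x, f x ∂ν
  have hind' : iIndepFun (fun j => f ∘ X j) μ := hind.comp (fun _ => f) fun _ => hf
  have hfX : ∀ j, AEMeasurable (f ∘ X j) μ := fun j => hf.comp_aemeasurable (hlaw j).aemeasurable
  have hmgf : ∀ j, mgf (f ∘ X j) μ l ≤ Real.exp (l * e + (1 / 2 + 2 * c / 9) * l ^ 2 * V) := by
    intro j
    have h1 : mgf (f ∘ X j) μ l = ∫ x, Real.exp (l * f x) ∂ν :=
      (hlaw j).integral_comp (f := fun x => Real.exp (l * f x))
        (by fun_prop)
    have hi : Integrable f ν := integrable_of_abs_le hf hC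
    have hi2 : Integrable (fun x => f x ^ 2) ν :=
      integrable_of_abs_le (hf.pow_const 2) (C := C ^ 2) fun x => by
        rw [abs_pow]
        exact pow_le_pow_left₀ (abs_nonneg _) (hC x) 2
    have hi3 : Integrable (fun x => Real.exp (l * f x)) ν :=
      integrable_of_abs_le (by fun_prop) (C := Real.exp c) fun x => by
        rw [abs_of_pos (Real.exp_pos _)]
        exact Real.exp_le_exp.2 (hlf x)
    rw [h1]
    calc ∫ x, Real.exp (l * f x) ∂ν
        ≤ ∫ x, (1 + l * f x + (1 / 2 + 2 * c / 9) * l ^ 2 * f x ^ 2) ∂ν := by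
          refine integral_mono hi3 (((integrable_const _).add (hi.const_mul _)).add
            (hi2.const_mul _)) fun x => ?_
          have := exp_le_one_add_add_sq hc hc1 (hlf x)
          simp only
          linarith [mul_pow l (f x) 2 ▸ this]
      _ = 1 + l * e + (1 / 2 + 2 * c / 9) * l ^ 2 * ∫ x, f x ^ 2 ∂ν := by
          have i1 : Integrable (fun x => 1 + l * f x) ν := (integrable_const _).add (hi.const_mul _)
          rw [integral_add i1 (hi2.const_mul _), integral_add (integrable_const _) (hi.const_mul _),
            integral_const_mul, integral_const_mul]
          simp [e]
      _ ≤ 1 + l * e + (1 / 2 + 2 * c / 9) * l ^ 2 * V := by gcongr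
      _ ≤ _ := by
          have := Real.add_one_le_exp (l * e + (1 / 2 + 2 * c / 9) * l ^ 2 * V)
          linarith
  have hsum : ∀ ω, (∑ j ∈ Finset.range n, f ∘ X j) ω = ∑ j : Fin n, f (X j ω) := fun ω => by
    simp [Finset.sum_apply, Finset.sum_range]
  have hint : Integrable (fun ω => Real.exp (l * (∑ j ∈ Finset.range n, f ∘ X j) ω)) μ := by
    refine Integrable.of_bound (C := Real.exp (n * c)) ?_ (Filter.Eventually.of_forall fun ω => ?_)
    · exact (Real.measurable_exp.comp_aemeasurable ((Finset.aemeasurable_sum _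
        fun j _ => hfX j).const_mul l)).aestronglyMeasurable
    · rw [Real.norm_of_nonneg (Real.exp_pos _).le, hsum, Real.exp_le_exp, Finset.mul_sum]
      calc _ ≤ ∑ _j : Fin n, c := Finset.sum_le_sum fun j _ => hlf _
        _ = _ := by simp
  have h := measure_ge_le_exp_mul_mgf (μ := μ) (n * e + s) hl hint
  simp only [hsum] at h
  refine h.trans ?_
  rw [hind'.mgf_sum₀ hfX]
  calc _ ≤ Real.exp (-l * (n * e + s)) *
        ∏ _j ∈ Finset.range n, Real.exp (l * e + (1 / 2 + 2 * c / 9) * l ^ 2 * V) := by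
        gcongr with j _
        · exact fun i _ => mgf_nonneg
        · exact hmgf j
    _ = _ := by
        rw [Finset.prod_const, Finset.card_range, ← Real.exp_nat_mul, ← Real.exp_add]
        congr 1
        ring

/-- Hoeffding's inequality for a function of i.i.d. variables with values in `[a, d]`. -/
lemma measureReal_sum_ge_le_hoeffding (hlaw : ∀ j, HasLaw (X j) ν μ) (hind : iIndepFun X μ)
    {f : ℝ → ℝ} (hf : Measurable f) {a d : ℝ} (had : ∀ x, f x ∈ Set.Icc a d)
    (n : ℕ) {s : ℝ} (hs : 0 ≤ s) :
    μ.real {ω | n * (∫ x, f x ∂ν) + s ≤ ∑ j : Fin n, f (X j ω)} ≤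
      Real.exp (-(2 * s ^ 2 / (n * (d - a) ^ 2))) := by
  have hfX : ∀ j, AEMeasurable (f ∘ X j) μ := fun j => hf.comp_aemeasurable (hlaw j).aemeasurable
  have hmean : ∀ j, ∫ ω, (f ∘ X j) ω ∂μ = ∫ x, f x ∂ν := fun j =>
    (hlaw j).integral_comp hf.aestronglyMeasurable
  have hind' : iIndepFun (fun j ω => (f ∘ X j) ω - ∫ ω, (f ∘ X j) ω ∂μ) μ :=
    hind.comp (fun j x => f x - ∫ ω, (f ∘ X j) ω ∂μ) fun _ => hf.sub_const _
  have h := HasSubgaussianMGF.measure_sum_range_ge_le_of_iIndepFun hind' (n := n)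
    (fun j _ => hasSubgaussianMGF_of_mem_Icc (hfX j)
      (Filter.Eventually.of_forall fun ω => had (X j ω))) hs
  convert h using 2
  · ext ω
    simp only [Set.mem_ofPred_eq, hmean, Finset.sum_sub_distrib]
    simp only [Finset.sum_const, Finset.card_range, nsmul_eq_mul, Finset.sum_range,
      Function.comp_apply]
    constructor <;> intro h <;> linarith
  · push_cast
    rw [div_pow, Real.norm_eq_abs, sq_abs, neg_div]
    congr 1
    -- If the denominator vanishes, both exponents are `0` by the convention for division by zero.
    rcases eq_or_ne ((n : ℝ) * (d - a) ^ 2) 0 with h0 | h0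
    · rw [h0, show 2 * (n : ℝ) * ((d - a) ^ 2 / 2 ^ 2) = (n * (d - a) ^ 2) / 2 by ring, h0]
      simp
    · have : (n : ℝ) ≠ 0 := left_ne_zero_of_mul h0
      have : (d - a) ^ 2 ≠ 0 := right_ne_zero_of_mul h0
      field_simp

/-- I.i.d. samples from an atomless law are almost surely distinct. -/
lemma ae_injective (hlaw : ∀ j, HasLaw (X j) ν μ) (hind : iIndepFun X μ)
    (hν : ∀ x, ν {x} = 0) : ∀ᵐ ω ∂μ, Function.Injective fun j => X j ω := by
  have hpair : ∀ i j, i ≠ j → ∀ᵐ ω ∂μ, X i ω ≠ X j ω := by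
    intro i j hij
    have hl := (hind.indepFun hij).hasLaw_prod (hlaw i) (hlaw j)
    have hm : MeasurableSet {q : ℝ × ℝ | q.1 = q.2} :=
      measurableSet_eq_fun measurable_fst measurable_snd
    rw [ae_iff]
    simp only [ne_eq, not_not]
    rw [hl.measure_eq (p := fun q : ℝ × ℝ => q.1 = q.2) hm, Measure.prod_apply hm]
    simp only [Set.preimage_ofPred_eq]
    simp [Set.ofPred_eq_eq_singleton', hν]
  have : ∀ᵐ ω ∂μ, ∀ i j, i ≠ j → X i ω ≠ X j ω := by
    simp only [ae_all_iff]
    exact hpair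
  filter_upwards [this] with ω h i j hij
  by_contra hne
  exact h i j hne hij

end Tail

/-! ### Moments and truncation -/

section Moments

variable {ν : Measure ℝ} [IsProbabilityMeasure ν] {p b : ℝ}

lemma abs_le_rpow_div (hp : 1 < p) (hb : 0 < b) {x : ℝ} (hx : b ≤ |x|) :
    |x| ≤ |x| ^ p / b ^ (p - 1) := by
  rw [le_div_iff₀ (Real.rpow_pos_of_pos hb _)]
  calc |x| * b ^ (p - 1) ≤ |x| * |x| ^ (p - 1) := by gcongr
    _ = |x| ^ p := by
        rw [← Real.rpow_one_add' (abs_nonneg _) (by linarith)]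
        congr 1
        ring

lemma integrable_id_of_rpow (hp : 1 < p) (hint : Integrable (fun x : ℝ => |x| ^ p) ν) :
    Integrable (fun x : ℝ => x) ν := by
  refine ((integrable_const (1 : ℝ)).add hint).mono' (by fun_prop)
    (Filter.Eventually.of_forall fun x => ?_)
  rw [Real.norm_eq_abs, Pi.add_apply]
  rcases le_total 1 |x| with h | h
  · have := abs_le_rpow_div hp one_pos h
    simp only [Real.one_rpow, div_one] at this
    linarith
  · have := Real.rpow_nonneg (abs_nonneg x) p
    linarith

lemma measurable_truncate (b : ℝ) : Measurable fun x : ℝ => if |x| ≤ b then x else 0 :=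
  Measurable.ite (measurableSet_le (by fun_prop) measurable_const) measurable_id measurable_const

lemma abs_truncate_le (hb : 0 ≤ b) (x : ℝ) : |if |x| ≤ b then x else 0| ≤ b := by
  split_ifs with h
  · exact h
  · simpa using hb

lemma abs_integral_sub_integral_truncate_le (hp : 1 < p) (hb : 0 < b)
    (hint : Integrable (fun x : ℝ => |x| ^ p) ν) :
    |(∫ x, x ∂ν) - ∫ x, (if |x| ≤ b then x else 0) ∂ν| ≤ (∫ x, |x| ^ p ∂ν) / b ^ (p - 1) := by
  have hi := integrable_id_of_rpow hp hint
  have ht : Integrable (fun x : ℝ => if |x| ≤ b then x else 0) ν :=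
    integrable_of_abs_le (measurable_truncate b) (abs_truncate_le hb.le)
  rw [← integral_sub hi ht, ← integral_div]
  refine (abs_integral_le_integral_abs).trans ?_
  refine integral_mono (hi.sub ht).abs (hint.div_const _) fun x => ?_
  simp only
  split_ifs with h
  · rw [sub_self, abs_zero]
    positivity
  · rw [sub_zero]
    exact abs_le_rpow_div hp hb (not_le.1 h).le

/-- For `p ≤ 2`, `x² ≤ |x|^p * b^(2-p)` on `|x| ≤ b`. For `p > 2`, Bernoulli gives `x² ≤ (2/p) *
|x|^p + (1 - 2/p)`, and `B ≥ 1` absorbs the constant. -/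
lemma integral_truncate_sq_le {B : ℝ} (hp : 1 < p) (hb : 0 < b) (hC : CondC2 p B ν)
    (hB : 2 < p → 1 ≤ B) :
    ∫ x, (if |x| ≤ b then x else 0) ^ 2 ∂ν ≤ B * b ^ (1 - min (p - 1) 1) := by
  obtain ⟨hint, hlt⟩ := hC
  have hi : Integrable (fun x : ℝ => (if |x| ≤ b then x else 0) ^ 2) ν :=
    integrable_of_abs_le ((measurable_truncate b).pow_const 2) (C := b ^ 2) fun x => by
      rw [abs_pow]
      exact pow_le_pow_left₀ (abs_nonneg _) (abs_truncate_le hb.le x) 2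
  rcases le_or_gt p 2 with hp2 | hp2
  · rw [min_eq_left (by linarith), show 1 - (p - 1) = 2 - p by ring]
    calc _ ≤ ∫ x, |x| ^ p * b ^ (2 - p) ∂ν := by
          refine integral_mono hi (hint.mul_const _) fun x => ?_
          simp only
          split_ifs with h
          · calc x ^ 2 = |x| ^ (2 : ℝ) := by rw [Real.rpow_two, sq_abs]
              _ = |x| ^ p * |x| ^ (2 - p) := by
                  rw [← Real.rpow_add' (abs_nonneg x) (by norm_num)]
                  congr 1
                  ring
              _ ≤ _ := by gcongr
          · rw [zero_pow two_ne_zero]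
            positivity
      _ ≤ _ := by
          rw [integral_mul_const]
          gcongr
  · rw [min_eq_right (by linarith), sub_self, Real.rpow_zero, mul_one]
    have hp0 : 0 < p := by linarith
    have hr : 2 / p ≤ 1 := (div_le_one hp0).2 hp2.le
    have hi1 : Integrable (fun x : ℝ => 2 / p * |x| ^ p) ν := hint.const_mul _
    calc _ ≤ ∫ x, (2 / p * |x| ^ p + (1 - 2 / p)) ∂ν := by
          refine integral_mono hi (hi1.add (integrable_const _)) fun x => ?_
          have h0 : (if |x| ≤ b then x else 0) ^ 2 ≤ x ^ 2 := by
            split_ifs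
            · exact le_rfl
            · rw [zero_pow two_ne_zero]
              positivity
          have h1 : x ^ 2 = (1 + (|x| ^ p - 1)) ^ (2 / p) := by
            rw [add_sub_cancel, ← Real.rpow_mul (abs_nonneg x), mul_div_cancel₀ _ hp0.ne',
              Real.rpow_two, sq_abs]
          have h2 := rpow_one_add_le_one_add_mul_self (s := |x| ^ p - 1) (p := 2 / p)
            (by linarith [Real.rpow_nonneg (abs_nonneg x) p]) (by positivity) hr
          simp only
          linarith
      _ = 2 / p * (∫ x, |x| ^ p ∂ν) + (1 - 2 / p) := by
          rw [integral_add hi1 (integrable_const _), integral_const_mul]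
          simp
      _ ≤ 2 / p * B + (1 - 2 / p) * B := by
          have := hB hp2
          gcongr
          nlinarith
      _ = B := by ring

lemma measureReal_mul_rpow_le (hp : 1 < p) (hb : 0 < b)
    (hint : Integrable (fun x : ℝ => |x| ^ p) ν) {A : Set ℝ} (hA : MeasurableSet A)
    (hAb : ∀ x ∈ A, b ≤ |x|) : ν.real A ≤ (∫ x, |x| ^ p ∂ν) / b ^ p := by
  rw [← integral_indicator_one hA, ← integral_div]
  refine integral_mono ((integrable_const (1 : ℝ)).indicator hA) (hint.div_const _) fun x => ?_
  by_cases hx : x ∈ A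
  · rw [Set.indicator_of_mem hx, Pi.one_apply, le_div_iff₀ (Real.rpow_pos_of_pos hb _), one_mul]
    have := hAb x hx
    gcongr
  · rw [Set.indicator_of_notMem hx]
    positivity

end Moments

/-! ### Concentration of the truncated mean -/

section Mean

variable {Ω : Type*} [MeasurableSpace Ω] {μ : Measure Ω} [IsProbabilityMeasure μ]
  {ν : Measure ℝ} [IsProbabilityMeasure ν] {X : ℕ → Ω → ℝ}

lemma measureReal_sum_ge_le_of_small_variance (hlaw : ∀ j, HasLaw (X j) ν μ)
    (hind : iIndepFun X μ) {f : ℝ → ℝ} (hf : Measurable f) {b D : ℝ} (hb : 0 < b) (hD : 0 ≤ D)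
    (hfb : ∀ x, |f x| ≤ b) (hV : ∫ x, f x ^ 2 ∂ν ≤ b * D) {n : ℕ} (hn : 1 ≤ n) :
    μ.real {ω | n * (∫ x, f x ∂ν) + n * (2 * D) ≤ ∑ j : Fin n, f (X j ω)} ≤
      2 * Real.exp (-(3 / 4 * (n + 1) * D / b)) := by
  have hn' : (1 : ℝ) ≤ n := by exact_mod_cast hn
  rcases le_or_gt D b with hDb | hDb
  · refine (measureReal_sum_ge_le_exp hlaw hind hf hfb (l := 1 / b) (c := 1) (V := b * D)
      (by positivity) zero_le_one le_rfl (fun x => ?_) hV n _).trans ?_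
    · rw [one_div_mul_eq_div, div_le_one hb]
      exact (le_abs_self _).trans (hfb x)
    · have h2 : Real.exp (Real.log 2) = 2 := Real.exp_log two_pos
      rw [← h2, ← Real.exp_add, h2, Real.exp_le_exp]
      have hu : D / b ≤ 1 := (div_le_one hb).2 hDb
      have hu0 : 0 ≤ D / b := by positivity
      have e1 : -(1 / b * (n * (2 * D))) + n * ((1 / 2 + 2 * 1 / 9) * (1 / b) ^ 2 * (b * D)) =
          -(23 / 18) * (n * (D / b)) := by
        field_simp
        ring
      have e2 : 3 / 4 * ((n : ℝ) + 1) * D / b = 3 / 4 * (n + 1) * (D / b) := by ring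
      rw [e1, e2]
      have := Real.log_two_gt_d9
      nlinarith [mul_nonneg (sub_nonneg.2 hn') hu0]
  -- For `D > b` the threshold exceeds `n * b`, the largest possible value of the sum.
  · have : {ω | n * (∫ x, f x ∂ν) + n * (2 * D) ≤ ∑ j : Fin n, f (X j ω)} = ∅ := by
      ext ω
      simp only [Set.mem_ofPred_eq, Set.mem_empty_iff_false, iff_false, not_le]
      have h1 : ∑ j : Fin n, f (X j ω) ≤ n * b := by
        calc _ ≤ ∑ _j : Fin n, b := Finset.sum_le_sum fun j _ => (le_abs_self _).trans (hfb _)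
          _ = _ := by simp
      have h2 : -b ≤ ∫ x, f x ∂ν := by
        have h3 := norm_integral_le_of_norm_le_const (μ := ν) (f := f) (C := b)
          (Filter.Eventually.of_forall hfb)
        simp only [Real.norm_eq_abs, probReal_univ, mul_one] at h3
        exact (abs_le.1 h3).1
      nlinarith
    rw [this, measureReal_empty]
    positivity

/-- The deviation `3 * D` is spent as `D` on truncation bias and `2 * D` on fluctuation. -/
lemma measureReal_truncMean_ge_le (hlaw : ∀ j, HasLaw (X j) ν μ) (hind : iIndepFun X μ)
    {b D : ℝ} (hb : 0 < b) (hD : 0 ≤ D)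
    (hbias : |(∫ x, x ∂ν) - ∫ x, (if |x| ≤ b then x else 0) ∂ν| ≤ D)
    (hV : ∫ x, (if |x| ≤ b then x else 0) ^ 2 ∂ν ≤ b * D) {n : ℕ} (hn : 1 ≤ n) :
    μ.real {ω | (∫ x, x ∂ν) + 3 * D ≤ truncMean b fun j : Fin n => X j ω} ≤
      2 * Real.exp (-(3 / 4 * (n + 1) * D / b)) := by
  have hn' : (0 : ℝ) < n := by exact_mod_cast hn
  refine (measureReal_mono fun ω hω => ?_).trans
    (measureReal_sum_ge_le_of_small_variance hlaw hind (measurable_truncate b) hb hD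
      (abs_truncate_le hb.le) hV hn)
  simp only [Set.mem_ofPred_eq, truncMean] at hω ⊢
  rw [le_div_iff₀ hn'] at hω
  have := (abs_le.1 hbias).1
  nlinarith

lemma measureReal_truncMean_le_le (hlaw : ∀ j, HasLaw (X j) ν μ) (hind : iIndepFun X μ)
    {b D : ℝ} (hb : 0 < b) (hD : 0 ≤ D)
    (hbias : |(∫ x, x ∂ν) - ∫ x, (if |x| ≤ b then x else 0) ∂ν| ≤ D)
    (hV : ∫ x, (if |x| ≤ b then x else 0) ^ 2 ∂ν ≤ b * D) {n : ℕ} (hn : 1 ≤ n) :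
    μ.real {ω | (truncMean b fun j : Fin n => X j ω) ≤ (∫ x, x ∂ν) - 3 * D} ≤
      2 * Real.exp (-(3 / 4 * (n + 1) * D / b)) := by
  have hn' : (0 : ℝ) < n := by exact_mod_cast hn
  refine (measureReal_mono fun ω hω => ?_).trans
    (measureReal_sum_ge_le_of_small_variance hlaw hind (measurable_truncate b).neg hb hD
      (fun x => by rw [Pi.neg_apply, abs_neg]; exact abs_truncate_le hb.le x)
      (by simpa using hV) hn)
  simp only [Set.mem_ofPred_eq, truncMean, Pi.neg_apply, integral_neg, Finset.sum_neg_distrib]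
    at hω ⊢
  rw [div_le_iff₀ hn'] at hω
  have := (abs_le.1 hbias).2
  nlinarith

end Mean

/-! ### Quantiles and clipping -/

section Quantile

variable {ν : Measure ℝ} [IsProbabilityMeasure ν] {α b : ℝ}

/-- Continuity puts `α` in the range of the CDF and makes the superlevel set closed, so the infimum
is attained. -/
lemma cdf_valueAtRisk (hc : Continuous (cdf ν)) (hα : α ∈ Set.Ioo (0 : ℝ) 1) :
    cdf ν (valueAtRisk α ν) = α := by
  obtain ⟨t₀, ht₀⟩ : ∃ t, cdf ν t ≤ α :=
    ((tendsto_cdf_atBot ν).eventually (eventually_lt_nhds hα.1)).exists.imp fun _ h => h.le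
  obtain ⟨t₁, ht₁⟩ : ∃ t, α ≤ cdf ν t :=
    ((tendsto_cdf_atTop ν).eventually (eventually_gt_nhds hα.2)).exists.imp fun _ h => h.le
  obtain ⟨l, hl⟩ : ∃ t, cdf ν t < α :=
    ((tendsto_cdf_atBot ν).eventually (eventually_lt_nhds hα.1)).exists
  obtain ⟨t, ht⟩ := mem_range_of_exists_le_of_exists_ge hc ⟨t₀, ht₀⟩ ⟨t₁, ht₁⟩
  have hbdd : BddBelow {t : ℝ | α ≤ cdf ν t} := ⟨l, fun s hs => by
    by_contra h
    exact absurd (monotone_cdf ν (not_le.1 h).le) (not_le.2 (hl.trans_le hs))⟩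
  have hmem : valueAtRisk α ν ∈ {t : ℝ | α ≤ cdf ν t} :=
    (isClosed_le continuous_const hc).csInf_mem ⟨t, ht.ge⟩ hbdd
  exact le_antisymm ((monotone_cdf ν (csInf_le hbdd ht.ge)).trans ht.le) hmem

lemma measure_singleton_eq_zero (hc : Continuous (cdf ν)) (x : ℝ) : ν {x} = 0 := by
  rw [← measure_cdf ν, StieltjesFunction.measure_singleton,
    (hc.continuousAt.continuousWithinAt).leftLim_eq, sub_self, ENNReal.ofReal_zero]

lemma measureReal_Iio_valueAtRisk (hc : Continuous (cdf ν)) (hα : α ∈ Set.Ioo (0 : ℝ) 1) :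
    ν.real (Set.Iio (valueAtRisk α ν)) = α := by
  have : NullSingletonClass ν := ⟨measure_singleton_eq_zero hc⟩
  rw [measureReal_congr Iio_ae_eq_Iic, ← cdf_eq_real, cdf_valueAtRisk hc hα]

lemma measureReal_Ici_valueAtRisk (hc : Continuous (cdf ν)) (hα : α ∈ Set.Ioo (0 : ℝ) 1) :
    ν.real (Set.Ici (valueAtRisk α ν)) = 1 - α := by
  rw [← Set.compl_Iio, probReal_compl_eq_one_sub measurableSet_Iio,
    measureReal_Iio_valueAtRisk hc hα]

lemma neg_lt_valueAtRisk (hc : Continuous (cdf ν)) (hα : α ∈ Set.Ioo (0 : ℝ) 1)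
    (hb : ν.real (Set.Iic (-b)) < α) : -b < valueAtRisk α ν := by
  by_contra! h
  have := monotone_cdf ν h
  rw [cdf_valueAtRisk hc hα, cdf_eq_real] at this
  linarith

lemma valueAtRisk_lt (hc : Continuous (cdf ν)) (hα : α ∈ Set.Ioo (0 : ℝ) 1)
    (hb : ν.real (Set.Ici b) < 1 - α) : valueAtRisk α ν < b := by
  by_contra! h
  have := measureReal_mono (μ := ν) (Set.Ici_subset_Ici.2 h)
  rw [measureReal_Ici_valueAtRisk hc hα] at this
  linarith

lemma abs_clip_le (hb : 0 ≤ b) (x : ℝ) : |clip b x| ≤ b :=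
  abs_le.2 ⟨le_min (le_max_left _ _) (by linarith), min_le_right _ _⟩

lemma measurable_clip (b : ℝ) : Measurable (clip b) := by
  unfold clip
  fun_prop

lemma clip_eq_self {x : ℝ} (h1 : -b ≤ x) (h2 : x ≤ b) : clip b x = x := by
  rw [clip, max_eq_right h1, min_eq_left h2]

lemma clip_of_le {x : ℝ} (hb : 0 ≤ b) (h : x ≤ -b) : clip b x = -b := by
  rw [clip, max_eq_left h, min_eq_left (by linarith)]

lemma clip_of_ge {x : ℝ} (h : b ≤ x) : clip b x = b :=
  min_eq_right (h.trans (le_max_right _ _))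

lemma le_clip_iff {x t : ℝ} (h1 : -b < t) (h2 : t ≤ b) : t ≤ clip b x ↔ t ≤ x := by
  rw [clip, le_min_iff, le_max_iff]
  constructor
  · rintro ⟨h | h, -⟩
    · linarith
    · exact h
  · exact fun h => ⟨Or.inr h, h2⟩

lemma clip_le_neg_iff {x : ℝ} (hb : 0 < b) : clip b x ≤ -b ↔ x ≤ -b := by
  constructor
  · intro h
    by_contra! hx
    rcases le_total x b with h' | h'
    · rw [clip_eq_self hx.le h'] at h
      linarith
    · rw [clip_of_ge h'] at h
      linarith
  · exact fun h => (clip_of_le hb.le h).le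

lemma eq_of_clip_eq {x t : ℝ} (h1 : -b < t) (h2 : t < b) (h : clip b x = t) : x = t := by
  rcases le_total x (-b) with hx | hx
  · rw [clip_of_le (by linarith) hx] at h
    linarith
  · rcases le_total b x with hx' | hx'
    · rw [clip_of_ge hx'] at h
      linarith
    · rwa [clip_eq_self hx hx'] at h

lemma integrable_clip (hb : 0 ≤ b) : Integrable (clip b) ν :=
  integrable_of_abs_le (measurable_clip b) (abs_clip_le hb)

/-- The conditional value at risk in terms of the clipped loss. -/
lemma mul_cvar_eq (hc : Continuous (cdf ν)) (hα : α ∈ Set.Ioo (0 : ℝ) 1)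
    (hi : Integrable (fun x : ℝ => x) ν)
    (h1 : -b < valueAtRisk α ν) (h2 : valueAtRisk α ν < b) :
    (1 - α) * cvar α ν = (∫ x, (Set.Ici (valueAtRisk α ν)).indicator (clip b) x ∂ν) +
      ∫ x, max 0 (x - b) ∂ν := by
  have hβ : (1 - α) ≠ 0 := by linarith [hα.2]
  have hmass := measureReal_Ici_valueAtRisk hc hα
  rw [cvar, mul_add, ← mul_assoc, mul_one_div_cancel hβ, one_mul]
  set v := valueAtRisk α ν
  have i1 : Integrable ((Set.Ici v).indicator (clip b)) ν :=
    (integrable_clip (by linarith)).indicator measurableSet_Ici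
  have i2 : Integrable (fun x => max 0 (x - b)) ν :=
    (integrable_const (0 : ℝ)).sup (hi.sub (integrable_const b))
  have i3 : Integrable ((Set.Ici v).indicator fun _ => v) ν :=
    (integrable_const v).indicator measurableSet_Ici
  have hpt : ∀ x, max 0 (x - v) = ((Set.Ici v).indicator (clip b) x + max 0 (x - b)) -
      (Set.Ici v).indicator (fun _ => v) x := by
    intro x
    by_cases hx : v ≤ x
    · rw [Set.indicator_of_mem (Set.mem_Ici.2 hx), Set.indicator_of_mem (Set.mem_Ici.2 hx),
        max_eq_right (by linarith)]
      rcases le_total x b with hxb | hxb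
      · rw [clip_eq_self (by linarith) hxb, max_eq_left (by linarith)]
        ring
      · rw [clip_of_ge hxb, max_eq_right (by linarith)]
        ring
    · rw [Set.indicator_of_notMem (by simpa using hx), Set.indicator_of_notMem (by simpa using hx),
        max_eq_left (by linarith), max_eq_left (by linarith)]
      ring
  simp_rw [hpt]
  have i12 : Integrable (fun x => (Set.Ici v).indicator (clip b) x + max 0 (x - b)) ν := i1.add i2
  rw [integral_sub i12 i3, integral_add i1 i2, integral_indicator_const v measurableSet_Ici, hmass,
    smul_eq_mul]
  ring

/-- The two terms live on the disjoint sets `x ≥ b` and `x ≤ -b`, so a single moment bound covers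
both. -/
lemma integral_excess_add_le {p : ℝ} (hp : 1 < p) (hb : 0 < b)
    (hint : Integrable (fun x : ℝ => |x| ^ p) ν) :
    (∫ x, max 0 (x - b) ∂ν) + b * ν.real (Set.Iic (-b)) ≤ (∫ x, |x| ^ p ∂ν) / b ^ (p - 1) := by
  have i2 : Integrable (fun x => max 0 (x - b)) ν :=
    (integrable_const (0 : ℝ)).sup ((integrable_id_of_rpow hp hint).sub (integrable_const b))
  have i3 : Integrable ((Set.Iic (-b)).indicator fun _ => b) ν :=
    (integrable_const b).indicator measurableSet_Iic
  have e : b * ν.real (Set.Iic (-b)) = ∫ x, (Set.Iic (-b)).indicator (fun _ => b) x ∂ν := by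
    rw [integral_indicator_const b measurableSet_Iic, smul_eq_mul, mul_comm]
  rw [e, ← integral_add i2 i3, ← integral_div]
  refine integral_mono (i2.add i3) (hint.div_const _) fun x => ?_
  have h0 : 0 ≤ |x| ^ p / b ^ (p - 1) := by positivity
  simp only
  by_cases hx : x ≤ -b
  · rw [Set.indicator_of_mem (Set.mem_Iic.2 hx), max_eq_left (by linarith), zero_add]
    have : b ≤ |x| := by rw [abs_of_nonpos (by linarith)]; linarith
    exact this.trans (abs_le_rpow_div hp hb this)
  · rw [Set.indicator_of_notMem (by simpa using hx), add_zero]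
    rcases le_total x b with hxb | hxb
    · rwa [max_eq_left (by linarith)]
    · rw [max_eq_right (by linarith)]
      have h1 : b ≤ |x| := hxb.trans (le_abs_self x)
      linarith [abs_le_rpow_div hp hb h1, le_abs_self x]

/-- Used when the empirical quantile is clipped at `b`: it relates the CVaR to the mass of `[b, ∞)`.
-/
lemma le_integral_Ici_clip (hb : 0 ≤ b) {v : ℝ} (hv : v ≤ b) :
    2 * b * ν.real (Set.Ici b) - b * ν.real (Set.Ici v) ≤
      ∫ x, (Set.Ici v).indicator (clip b) x ∂ν := by
  have i1 : Integrable ((Set.Ici b).indicator fun _ => 2 * b) ν :=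
    (integrable_const _).indicator measurableSet_Ici
  have i2 : Integrable ((Set.Ici v).indicator fun _ => b) ν :=
    (integrable_const _).indicator measurableSet_Ici
  have e1 : 2 * b * ν.real (Set.Ici b) = ∫ x, (Set.Ici b).indicator (fun _ => 2 * b) x ∂ν := by
    rw [integral_indicator_const _ measurableSet_Ici, smul_eq_mul, mul_comm]
  have e2 : b * ν.real (Set.Ici v) = ∫ x, (Set.Ici v).indicator (fun _ => b) x ∂ν := by
    rw [integral_indicator_const _ measurableSet_Ici, smul_eq_mul, mul_comm]
  rw [e1, e2, ← integral_sub i1 i2]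
  refine integral_mono (i1.sub i2) ((integrable_clip hb).indicator measurableSet_Ici) fun x => ?_
  simp only [Set.indicator_apply, Set.mem_Ici]
  have := (abs_le.1 (abs_clip_le hb x)).1
  split_ifs with h1 h2 h2
  · rw [clip_of_ge h1]
    linarith
  · linarith
  · linarith
  · simp

/-- Used when the empirical quantile is clipped at `-b`, where the estimator is governed by the full
clipped mean. -/
lemma integral_Ici_clip_sub_le (hb : 0 ≤ b) (v : ℝ) :
    (∫ x, (Set.Ici v).indicator (clip b) x ∂ν) - b * ν.real (Set.Iio v) ≤ ∫ x, clip b x ∂ν := by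
  have i1 : Integrable ((Set.Ici v).indicator (clip b)) ν :=
    (integrable_clip hb).indicator measurableSet_Ici
  have i2 : Integrable ((Set.Iio v).indicator fun _ => b) ν :=
    (integrable_const _).indicator measurableSet_Iio
  have e2 : b * ν.real (Set.Iio v) = ∫ x, (Set.Iio v).indicator (fun _ => b) x ∂ν := by
    rw [integral_indicator_const _ measurableSet_Iio, smul_eq_mul, mul_comm]
  rw [e2, ← integral_sub i1 i2]
  refine integral_mono (i1.sub i2) (integrable_clip hb) fun x => ?_
  simp only [Set.indicator_apply, Set.mem_Ici, Set.mem_Iio]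
  have := (abs_le.1 (abs_clip_le hb x)).1
  split_ifs <;> linarith

end Quantile

/-! ### Concentration of the clipped CVaR estimator -/

/-- Values strictly inside `(-b, b)` have one preimage under clipping, so distinct samples can tie
only at the endpoints. -/
lemma tailCount_clip_orderStat {n m : ℕ} {x : Fin n → ℝ} (hx : Function.Injective x) {b : ℝ}
    (hb : 0 ≤ b) (h1 : 1 ≤ m) (hn : m ≤ n) :
    tailCount (fun j => clip b (x j)) (orderStat (fun j => clip b (x j)) m) = m ∨
      orderStat (fun j => clip b (x j)) m = b ∨ orderStat (fun j => clip b (x j)) m = -b := by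
  obtain ⟨k, hk⟩ := exists_orderStat_eq (y := fun j => clip b (x j)) h1 hn
  have habs := abs_le.1 (hk ▸ abs_clip_le hb (x k))
  rcases habs.1.eq_or_lt with h | hl
  · exact Or.inr (Or.inr h.symm)
  rcases habs.2.eq_or_lt with h | hr
  · exact Or.inr (Or.inl h)
  left
  rw [tailCount_eq_card, card_orderStat_le_of_unique h1 hn]
  intro i j hi hj
  exact hx ((eq_of_clip_eq hl hr hi).trans (eq_of_clip_eq hl hr hj).symm)

lemma sum_ite_le_clip {n : ℕ} (x : Fin n → ℝ) {b v : ℝ} (h1 : -b < v) (h2 : v ≤ b)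
    (g : ℝ → ℝ) :
    (∑ j, if v ≤ clip b (x j) then g (x j) else 0) = ∑ j, (Set.Ici v).indicator g (x j) := by
  refine Finset.sum_congr rfl fun j _ => ?_
  simp only [le_clip_iff h1 h2, Set.indicator_apply, Set.mem_Ici]

lemma clippedCVaR_eq (α b : ℝ) {n : ℕ} (x : Fin n → ℝ) :
    clippedCVaR α b x = 1 / ((n : ℝ) * (1 - α)) * tailSum (fun j => clip b (x j))
      (orderStat (fun j => clip b (x j)) ⌊(n : ℝ) * (1 - α)⌋₊) := rfl

section Tail

variable {Ω : Type*} [MeasurableSpace Ω] {μ : Measure Ω} [IsProbabilityMeasure μ]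
  {ν : Measure ℝ} [IsProbabilityMeasure ν] {X : ℕ → Ω → ℝ} {α b θ : ℝ} {n : ℕ}

/-- Tail bound for a bounded function supported on the upper `β`-tail of the law. -/
lemma measureReal_sum_ge_le_of_support (hlaw : ∀ j, HasLaw (X j) ν μ) (hind : iIndepFun X μ)
    {f : ℝ → ℝ} (hf : Measurable f) {v β : ℝ} (hβ : ν.real (Set.Ici v) ≤ β)
    (hb : 0 < b) (hfb : ∀ x, |f x| ≤ 2 * b) (hf0 : ∀ x, x < v → f x = 0) (hθ : 0 < θ)
    (hθ1 : θ ≤ 1) (hQ : 20 ≤ n * β * θ ^ 2) :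
    μ.real {ω | n * (∫ x, f x ∂ν) + (n * β * θ * b - b) ≤ ∑ j : Fin n, f (X j ω)} ≤
      Real.exp (-(n * β * θ ^ 2 / 12)) := by
  have hV : ∫ x, f x ^ 2 ∂ν ≤ 4 * b ^ 2 * β := by
    have hsq : ∀ x, f x ^ 2 ≤ 4 * b ^ 2 := fun x => by
      have := pow_le_pow_left₀ (abs_nonneg _) (hfb x) 2
      rw [sq_abs] at this
      linarith
    calc ∫ x, f x ^ 2 ∂ν ≤ ∫ x, (Set.Ici v).indicator (fun _ => 4 * b ^ 2) x ∂ν := by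
          refine integral_mono (integrable_of_abs_le (hf.pow_const 2) (C := 4 * b ^ 2) fun x => ?_)
            ((integrable_const _).indicator measurableSet_Ici) fun x => ?_
          · rw [abs_of_nonneg (sq_nonneg _)]
            exact hsq x
          · by_cases hx : v ≤ x
            · rw [Set.indicator_of_mem (Set.mem_Ici.2 hx)]
              exact hsq x
            · simp only [Set.indicator_of_notMem (show x ∉ Set.Ici v by simpa using hx),
                hf0 x (not_le.1 hx)]
              norm_num
      _ ≤ _ := by
          rw [integral_indicator_const _ measurableSet_Ici, smul_eq_mul, mul_comm]
          gcongr
  -- With `Q = n * β * θ ^ 2` the exponent is about `-0.106 * Q + θ / 5`, where `θ / 5` comes from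
  -- the rounding loss `b`. The assumption `Q ≥ 20` brings it below `-Q / 12`.
  refine (measureReal_sum_ge_le_exp hlaw hind hf hfb (l := θ / (5 * b)) (c := 2 / 5)
    (by positivity) (by norm_num) (by norm_num) (fun x => ?_) hV n _).trans ?_
  · calc θ / (5 * b) * f x ≤ θ / (5 * b) * (2 * b) := by
          gcongr
          exact (le_abs_self _).trans (hfb x)
      _ = 2 / 5 * θ := by field_simp
      _ ≤ 2 / 5 := by linarith
  · rw [Real.exp_le_exp]
    have e : -(θ / (5 * b) * (n * β * θ * b - b)) +
        n * ((1 / 2 + 2 * (2 / 5) / 9) * (θ / (5 * b)) ^ 2 * (4 * b ^ 2 * β)) =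
        -(n * β * θ ^ 2 / 5) + θ / 5 + (1 / 2 + 4 / 45) * 4 / 25 * (n * β * θ ^ 2) := by
      field_simp
      ring
    rw [e]
    linarith

lemma floor_bounds (hα : α ∈ Set.Ioo (0 : ℝ) 1) (hN : 1 ≤ (n : ℝ) * (1 - α)) :
    1 ≤ ⌊(n : ℝ) * (1 - α)⌋₊ ∧ ⌊(n : ℝ) * (1 - α)⌋₊ ≤ n ∧
      (⌊(n : ℝ) * (1 - α)⌋₊ : ℝ) ≤ n * (1 - α) ∧
      (n : ℝ) * (1 - α) ≤ ⌊(n : ℝ) * (1 - α)⌋₊ + 1 := by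
  have h0 : (⌊(n : ℝ) * (1 - α)⌋₊ : ℝ) ≤ n * (1 - α) := Nat.floor_le (by linarith)
  refine ⟨Nat.le_floor (by simpa using hN), ?_, h0, (Nat.lt_floor_add_one _).le⟩
  have : (0 : ℝ) ≤ n := n.cast_nonneg
  exact_mod_cast h0.trans (show (n : ℝ) * (1 - α) ≤ n by nlinarith [hα.1])

lemma one_le_of_twenty_le (hα : α ∈ Set.Ioo (0 : ℝ) 1) (hθ : 0 < θ) (hθ1 : θ ≤ 1)
    (hQ : 20 ≤ n * (1 - α) * θ ^ 2) : 1 ≤ (n : ℝ) * (1 - α) := by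
  have h0 : 0 ≤ (n : ℝ) * (1 - α) := mul_nonneg n.cast_nonneg (by linarith [hα.2])
  have : θ ^ 2 ≤ 1 := pow_le_one₀ hθ.le hθ1
  nlinarith

lemma integral_Ici_indicator_clip_add (hc : Continuous (cdf ν)) (hα : α ∈ Set.Ioo (0 : ℝ) 1)
    (hb : 0 ≤ b) (s k : ℝ) :
    ∫ x, (Set.Ici (valueAtRisk α ν)).indicator (fun x => s * clip b x + k) x ∂ν =
      s * (∫ x, (Set.Ici (valueAtRisk α ν)).indicator (clip b) x ∂ν) + k * (1 - α) := by
  rw [integral_indicator measurableSet_Ici, integral_indicator measurableSet_Ici,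
    integral_add ((integrable_clip hb).const_mul s).integrableOn (integrable_const k).integrableOn,
    integral_const_mul]
  simp [measureReal_Ici_valueAtRisk hc hα, mul_comm]

lemma measurable_Ici_indicator_clip_add (v s k : ℝ) :
    Measurable ((Set.Ici v).indicator fun x => s * clip b x + k) :=
  (((measurable_clip b).const_mul s).add_const k).indicator measurableSet_Ici

lemma abs_Ici_indicator_clip_add_le {v s k : ℝ} (hb : 0 ≤ b) (hs : |s| ≤ 1) (hk : |k| ≤ b)
    (x : ℝ) : |(Set.Ici v).indicator (fun x => s * clip b x + k) x| ≤ 2 * b := by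
  rw [Set.indicator_apply]
  split_ifs
  · calc _ ≤ |s * clip b x| + |k| := abs_add_le _ _
      _ ≤ 1 * b + b := by
          rw [abs_mul]
          gcongr
          exact abs_clip_le hb x
      _ = 2 * b := by ring
  · rw [abs_zero]
    linarith

/-- Upper tail of the clipped CVaR estimator. -/
lemma measureReal_clippedCVaR_ge_le (hlaw : ∀ j, HasLaw (X j) ν μ) (hind : iIndepFun X μ)
    (hc : Continuous (cdf ν)) (hα : α ∈ Set.Ioo (0 : ℝ) 1) (hi : Integrable (fun x : ℝ => x) ν)
    (h1 : -b < valueAtRisk α ν) (h2 : valueAtRisk α ν < b) (hθ : 0 < θ) (hθ1 : θ ≤ 1)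
    (hQ : 20 ≤ n * (1 - α) * θ ^ 2) :
    μ.real {ω | cvar α ν + 2 * θ * b ≤ clippedCVaR α b fun j : Fin n => X j ω} ≤
      2 * Real.exp (-(n * (1 - α) * θ ^ 2 / 12)) := by
  have hN1 := one_le_of_twenty_le hα hθ hθ1 hQ
  obtain ⟨hm1, hmn, hmN, hNm⟩ := floor_bounds hα hN1
  have hcv := mul_cvar_eq hc hα hi h1 h2
  have hmass := measureReal_Ici_valueAtRisk hc hα
  have hb : 0 < b := by linarith
  have hJ1 := le_integral_Ici_clip (ν := ν) hb.le h2.le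
  have hJ2 := integral_Ici_indicator_clip_add hc hα hb.le 1 (-valueAtRisk α ν)
  have hex : 0 ≤ ∫ x, max 0 (x - b) ∂ν := integral_nonneg fun x => le_max_left _ _
  rw [hmass] at hJ1
  set v := valueAtRisk α ν
  set J := ∫ x, (Set.Ici v).indicator (clip b) x ∂ν
  set f := (Set.Ici v).indicator fun x => 1 * clip b x + -v
  set g := (Set.Ici b).indicator fun _ : ℝ => b
  have hg : ∫ x, g x ∂ν = ν.real (Set.Ici b) * b := by
    rw [integral_indicator_const _ measurableSet_Ici, smul_eq_mul]
  have hf1 := measureReal_sum_ge_le_of_support (n := n) (f := f) (v := v) hlaw hind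
    (measurable_Ici_indicator_clip_add _ _ _) hmass.le hb
    (abs_Ici_indicator_clip_add_le hb.le (by simp) (by
      rw [abs_neg]; exact abs_le.2 ⟨h1.le, h2.le⟩))
    (fun x hx => Set.indicator_of_notMem (by simpa using hx) _) hθ hθ1 hQ
  have hg1 := measureReal_sum_ge_le_of_support (n := n) (f := g) (v := v) hlaw hind
    (measurable_const.indicator measurableSet_Ici) hmass.le hb
    (fun x => by
      simp only [g, Set.indicator_apply]
      split_ifs
      · rw [abs_of_pos hb]
        linarith
      · rw [abs_zero]
        linarith)
    (fun x hx => Set.indicator_of_notMem (by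
      rw [Set.mem_Ici, not_le]
      linarith) _) hθ hθ1 hQ
  rw [hJ2] at hf1
  rw [hg] at hg1
  have hsub : {ω | cvar α ν + 2 * θ * b ≤ clippedCVaR α b fun j : Fin n => X j ω} ≤ᵐ[μ]
      ({ω | n * (1 * J + -v * (1 - α)) + (n * (1 - α) * θ * b - b) ≤ ∑ j : Fin n, f (X j ω)} ∪
        {ω | n * (ν.real (Set.Ici b) * b) + (n * (1 - α) * θ * b - b) ≤
          ∑ j : Fin n, g (X j ω)} : Set Ω) := by
    filter_upwards [ae_injective hlaw hind (measure_singleton_eq_zero hc)] with ω hinj hω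
    replace hω : cvar α ν + 2 * θ * b ≤ clippedCVaR α b fun j : Fin n => X j ω := hω
    have hx : Function.Injective fun j : Fin n => X j ω := fun i j h => Fin.ext (hinj h)
    have htie := tailCount_clip_orderStat hx hb.le hm1 hmn
    rw [clippedCVaR_eq, one_div_mul_eq_div, le_div_iff₀ (by linarith)] at hω
    set x : Fin n → ℝ := fun j => X j ω
    set y : Fin n → ℝ := fun j => clip b (x j)
    set m := ⌊(n : ℝ) * (1 - α)⌋₊
    have hn0 : (0 : ℝ) ≤ n := n.cast_nonneg
    -- For an upper bound a tie at `-b` is harmless, being nonpositive; only a tie at `b` needs its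
    -- own event.
    have hcase : (tailCount y (orderStat y m) = m ∨ orderStat y m ≤ 0) ∨ orderStat y m = b := by
      rcases htie with h | h | h
      · exact Or.inl (Or.inl h)
      · exact Or.inr h
      · exact Or.inl (Or.inr (by linarith))
    rcases hcase with h | h
    · left
      have hS := tailSum_orderStat_le hm1 hmn v h
      have hsum : tailSum y v - v * tailCount y v = ∑ j, f (x j) := by
        rw [tailSum_sub, ← sum_ite_le_clip x h1 h2.le]
        refine Finset.sum_congr rfl fun j _ => ?_
        simp only [y]
        split_ifs <;> ring
      change n * (1 * J + -v * (1 - α)) + (n * (1 - α) * θ * b - b) ≤ ∑ j, f (x j)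
      rw [hsum] at hS
      -- Rounding loss: `n * (1 - α) - m` lies in `[0, 1]` and `v > -b`.
      have hv : -b ≤ (n * (1 - α) - m) * v := by
        nlinarith [mul_nonneg (sub_nonneg.2 hmN) (by linarith : 0 ≤ v + b)]
      have hpos : 0 ≤ n * (1 - α) * θ * b := by
        have : 0 ≤ (n : ℝ) * (1 - α) := by linarith
        positivity
      have hnex := mul_nonneg hn0 hex
      have : cvar α ν * (n * (1 - α)) = n * J + n * ∫ x, max 0 (x - b) ∂ν := by
        rw [← mul_add, ← hcv]
        ring
      nlinarith
    · right
      have hsum : tailSum y b = ∑ j, g (x j) := by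
        rw [← sum_ite_le_clip x (by linarith) le_rfl]
        refine Finset.sum_congr rfl fun j _ => ?_
        simp only [y]
        split_ifs with hj
        · exact le_antisymm (abs_le.1 (abs_clip_le hb.le _)).2 hj
        · rfl
      have hcount : (m : ℝ) * b ≤ tailSum y b := by
        have hc1 : (m : ℝ) ≤ tailCount y (orderStat y m) := by
          rw [tailCount_eq_card]
          exact_mod_cast le_card_orderStat_le hm1 hmn
        rw [h, tailCount, ← sub_nonneg] at hc1
        have : tailCount y b * b ≤ tailSum y b := by
          rw [tailCount, tailSum, Finset.sum_mul]
          refine Finset.sum_le_sum fun j _ => ?_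
          split_ifs <;> linarith
        rw [tailCount] at this
        nlinarith
      -- Averaging two lower bounds for `tailSum y b`, namely `hω` and `hcount`, and bounding `J`
      -- below by `hJ1` shows that too many samples reach `b`.
      change n * (ν.real (Set.Ici b) * b) + (n * (1 - α) * θ * b - b) ≤ ∑ j, g (x j)
      rw [h, hsum] at hω
      rw [hsum] at hcount
      have hnex := mul_nonneg hn0 hex
      have hnJ := mul_le_mul_of_nonneg_left hJ1 hn0
      have : cvar α ν * (n * (1 - α)) = n * J + n * ∫ x, max 0 (x - b) ∂ν := by
        rw [← mul_add, ← hcv]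
        ring
      nlinarith
  calc _ ≤ _ := ENNReal.toReal_mono (measure_ne_top _ _) (measure_mono_ae hsub)
    _ ≤ _ := measureReal_union_le _ _
    _ ≤ _ := by linarith

/-- Lower tail of the clipped CVaR estimator when at least `n α` samples are clipped from below:
the estimator is then a multiple of the empirical mean. -/
lemma measureReal_clipped_below_le (hlaw : ∀ j, HasLaw (X j) ν μ) (hind : iIndepFun X μ)
    (hc : Continuous (cdf ν)) (hα : α ∈ Set.Ioo (0 : ℝ) 1) (hi : Integrable (fun x : ℝ => x) ν)
    (h1 : -b < valueAtRisk α ν) (h2 : valueAtRisk α ν < b) (hθ : 0 < θ) (hθ1 : θ ≤ 1)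
    (hbias : (∫ x, max 0 (x - b) ∂ν) + b * ν.real (Set.Iic (-b)) ≤ (1 - α) * θ * b)
    (hn : 0 < n) :
    μ.real {ω | n * α ≤ ∑ j : Fin n, (Set.Iic (-b)).indicator (fun _ => (1 : ℝ)) (X j ω) ∧
      ∑ j : Fin n, clip b (X j ω) ≤ n * (1 - α) * (cvar α ν - 2 * θ * b)} ≤
      Real.exp (-(n * (1 - α) * θ ^ 2 / 12)) := by
  have hn0 : (0 : ℝ) < n := by exact_mod_cast hn
  have hb : 0 < b := by linarith
  have hcv := mul_cvar_eq hc hα hi h1 h2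
  have hex : 0 ≤ ∫ x, max 0 (x - b) ∂ν := integral_nonneg fun x => le_max_left _ _
  have hmean := integral_Ici_clip_sub_le (ν := ν) hb.le (valueAtRisk α ν)
  rw [measureReal_Iio_valueAtRisk hc hα] at hmean
  have hα0 := hα.1
  have hβ0 : 0 < 1 - α := by linarith [hα.2]
  set J := ∫ x, (Set.Ici (valueAtRisk α ν)).indicator (clip b) x ∂ν
  set r := ν.real (Set.Iic (-b))
  set h := (Set.Iic (-b)).indicator fun _ : ℝ => (1 : ℝ)
  have hh : Measurable h := measurable_const.indicator measurableSet_Iic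
  have hh01 : ∀ x, 0 ≤ h x ∧ h x ≤ 1 := fun x => by
    simp only [h, Set.indicator_apply]
    split_ifs <;> norm_num
  have hhint : ∫ x, h x ∂ν = r := by
    rw [integral_indicator_const _ measurableSet_Iic, smul_eq_mul, mul_one]
  -- Hoeffding on a range of length `3 * b` gives `(2/9) * β * Q` with `Q = n * β * θ ^ 2`, which
  -- reaches `Q / 12` exactly when `β ≥ 3/8`. For smaller `β` the count of clipped samples alone is
  -- already improbable.
  rcases le_total (3 / 8) (1 - α) with hβ | hβ
  · have hrange : ∀ x, b * h x - clip b x ∈ Set.Icc (-b) (2 * b) := fun x => by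
      have hcl := abs_le.1 (abs_clip_le hb.le x)
      obtain ⟨hx0, hx1⟩ := hh01 x
      constructor <;> nlinarith
    have hint : ∫ x, (b * h x - clip b x) ∂ν = b * r - ∫ x, clip b x ∂ν := by
      rw [integral_sub (((integrable_const (1 : ℝ)).indicator measurableSet_Iic).const_mul b)
        (integrable_clip hb.le), integral_const_mul, hhint]
    have hoef := measureReal_sum_ge_le_hoeffding hlaw hind
      ((hh.const_mul b).sub (measurable_clip b)) hrange n
      (s := n * (1 - α) * θ * b) (by positivity)
    refine (measureReal_mono ?_).trans (hoef.trans ?_)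
    · rintro ω ⟨hω1, hω2⟩
      change n * (∫ x, (b * h x - clip b x) ∂ν) + n * (1 - α) * θ * b ≤
        ∑ j : Fin n, (b * h (X j ω) - clip b (X j ω))
      rw [hint, Finset.sum_sub_distrib, ← Finset.mul_sum]
      have e1 : n * (1 - α) * cvar α ν = n * J + n * ∫ x, max 0 (x - b) ∂ν := by
        rw [← mul_add, ← hcv]
        ring
      have e2 := mul_le_mul_of_nonneg_left hbias hn0.le
      have e3 := mul_le_mul_of_nonneg_left hmean hn0.le
      have e4 := mul_le_mul_of_nonneg_left hω1 hb.le
      nlinarith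
    · rw [Real.exp_le_exp, neg_le_neg_iff]
      have e : 2 * (n * (1 - α) * θ * b) ^ 2 / (n * (2 * b - -b) ^ 2) =
          2 / 9 * (1 - α) * (n * (1 - α) * θ ^ 2) := by
        field_simp
        ring
      rw [e]
      have : 0 ≤ n * (1 - α) * θ ^ 2 := by positivity
      nlinarith
  · have hoef := measureReal_sum_ge_le_hoeffding hlaw hind hh (a := 0) (d := 1) hh01 n
      (s := n / 4) (by positivity)
    refine (measureReal_mono ?_).trans (hoef.trans ?_)
    · rintro ω ⟨hω1, -⟩
      change n * (∫ x, h x ∂ν) + n / 4 ≤ ∑ j : Fin n, h (X j ω)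
      rw [hhint]
      have hr : r ≤ (1 - α) * θ := by
        have : b * r ≤ b * ((1 - α) * θ) := by linarith
        exact le_of_mul_le_mul_left this hb
      -- Here `r ≤ 3/8` and `α ≥ 5/8`.
      have hr2 : r + 1 / 4 ≤ α := by nlinarith
      have := mul_le_mul_of_nonneg_left hr2 hn0.le
      linarith
    · rw [Real.exp_le_exp, neg_le_neg_iff]
      have e : 2 * ((n : ℝ) / 4) ^ 2 / (n * (1 - 0) ^ 2) = n / 8 := by
        field_simp
        norm_num
      rw [e]
      have hθ2 : θ ^ 2 ≤ 1 := pow_le_one₀ hθ.le hθ1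
      have : (1 - α) * θ ^ 2 ≤ 1 := by nlinarith [sq_nonneg θ]
      nlinarith

/-- Lower tail of the clipped CVaR estimator. -/
lemma measureReal_clippedCVaR_le_le (hlaw : ∀ j, HasLaw (X j) ν μ) (hind : iIndepFun X μ)
    (hc : Continuous (cdf ν)) (hα : α ∈ Set.Ioo (0 : ℝ) 1) (hi : Integrable (fun x : ℝ => x) ν)
    (h1 : -b < valueAtRisk α ν) (h2 : valueAtRisk α ν < b) (hθ : 0 < θ) (hθ1 : θ ≤ 1)
    (hbias : (∫ x, max 0 (x - b) ∂ν) + b * ν.real (Set.Iic (-b)) ≤ (1 - α) * θ * b)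
    (hQ : 20 ≤ n * (1 - α) * θ ^ 2) :
    μ.real {ω | (clippedCVaR α b fun j : Fin n => X j ω) ≤ cvar α ν - 2 * θ * b} ≤
      3 * Real.exp (-(n * (1 - α) * θ ^ 2 / 12)) := by
  have hN1 := one_le_of_twenty_le hα hθ hθ1 hQ
  obtain ⟨hm1, hmn, hmN, hNm⟩ := floor_bounds hα hN1
  have hcv := mul_cvar_eq hc hα hi h1 h2
  have hmass := measureReal_Ici_valueAtRisk hc hα
  have hb : 0 < b := by linarith
  have hrare := measureReal_clipped_below_le (n := n) hlaw hind hc hα hi h1 h2 hθ hθ1 hbias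
    (by omega)
  have hf := integral_Ici_indicator_clip_add hc hα hb.le (-1) (-b)
  have hg := integral_Ici_indicator_clip_add hc hα hb.le (-1) b
  have hr0 : 0 ≤ b * ν.real (Set.Iic (-b)) := by positivity
  set v := valueAtRisk α ν
  set J := ∫ x, (Set.Ici v).indicator (clip b) x ∂ν
  set f := (Set.Ici v).indicator fun x => -1 * clip b x + -b
  set g := (Set.Ici v).indicator fun x => -1 * clip b x + b
  have hf1 := measureReal_sum_ge_le_of_support (n := n) (f := f) (v := v) hlaw hind
    (measurable_Ici_indicator_clip_add _ _ _) hmass.le hb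
    (abs_Ici_indicator_clip_add_le hb.le (by simp) (by rw [abs_neg, abs_of_pos hb]))
    (fun x hx => Set.indicator_of_notMem (by simpa using hx) _) hθ hθ1 hQ
  have hg1 := measureReal_sum_ge_le_of_support (n := n) (f := g) (v := v) hlaw hind
    (measurable_Ici_indicator_clip_add _ _ _) hmass.le hb
    (abs_Ici_indicator_clip_add_le hb.le (by simp) (by rw [abs_of_pos hb]))
    (fun x hx => Set.indicator_of_notMem (by simpa using hx) _) hθ hθ1 hQ
  rw [hf] at hf1
  rw [hg] at hg1
  set rare : Set Ω :=
    {ω | n * α ≤ ∑ j : Fin n, (Set.Iic (-b)).indicator (fun _ => (1 : ℝ)) (X j ω) ∧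
      ∑ j : Fin n, clip b (X j ω) ≤ n * (1 - α) * (cvar α ν - 2 * θ * b)}
  have hsub : {ω | (clippedCVaR α b fun j : Fin n => X j ω) ≤ cvar α ν - 2 * θ * b} ≤ᵐ[μ]
      (({ω | n * (-1 * J + -b * (1 - α)) + (n * (1 - α) * θ * b - b) ≤ ∑ j : Fin n, f (X j ω)} ∪
        {ω | n * (-1 * J + b * (1 - α)) + (n * (1 - α) * θ * b - b) ≤
          ∑ j : Fin n, g (X j ω)}) ∪ rare : Set Ω) := by
    filter_upwards [ae_injective hlaw hind (measure_singleton_eq_zero hc)] with ω hinj hω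
    replace hω : (clippedCVaR α b fun j : Fin n => X j ω) ≤ cvar α ν - 2 * θ * b := hω
    have hx : Function.Injective fun j : Fin n => X j ω := fun i j h => Fin.ext (hinj h)
    have htie := tailCount_clip_orderStat hx hb.le hm1 hmn
    rw [clippedCVaR_eq, one_div_mul_eq_div, div_le_iff₀ (by linarith)] at hω
    set x : Fin n → ℝ := fun j => X j ω
    set y : Fin n → ℝ := fun j => clip b (x j)
    set m := ⌊(n : ℝ) * (1 - α)⌋₊
    have hn0 : (0 : ℝ) ≤ n := n.cast_nonneg
    -- Opposite to the upper tail: a tie at `b` only raises the sum, while one at `-b` needs the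
    -- event `rare`.
    have hcase : (tailCount y (orderStat y m) = m ∨ 0 ≤ orderStat y m) ∨ orderStat y m = -b := by
      rcases htie with h | h | h
      · exact Or.inl (Or.inl h)
      · exact Or.inl (Or.inr (by linarith))
      · exact Or.inr h
    rcases hcase with h | h
    · left
      have e1 : (cvar α ν - 2 * θ * b) * (n * (1 - α)) ≤ n * J - n * (1 - α) * θ * b := by
        have e2 : cvar α ν * (n * (1 - α)) = n * J + n * ∫ x, max 0 (x - b) ∂ν := by
          rw [← mul_add, ← hcv]
          ring
        have e3 := mul_le_mul_of_nonneg_left hbias hn0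
        nlinarith [mul_nonneg hn0 hr0]
      have hsum : ∀ k, -(tailSum y v - k * tailCount y v) =
          ∑ j, (Set.Ici v).indicator (fun x => -1 * clip b x + k) (x j) := fun k => by
        rw [tailSum_sub, ← sum_ite_le_clip x h1 h2.le, ← Finset.sum_neg_distrib]
        refine Finset.sum_congr rfl fun j _ => ?_
        simp only [y]
        split_ifs <;> ring
      rcases tailSum_orderStat_ge (y := y) (v := v) hm1 hmn (fun j => abs_clip_le hb.le _) hmN hNm h
        with hS | hS
      · left
        change n * (-1 * J + -b * (1 - α)) + (n * (1 - α) * θ * b - b) ≤ ∑ j, f (x j)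
        rw [← hsum]
        linarith
      · right
        change n * (-1 * J + b * (1 - α)) + (n * (1 - α) * θ * b - b) ≤ ∑ j, g (x j)
        rw [← hsum]
        linarith
    · right
      refine ⟨?_, ?_⟩
      -- Fewer than `m ≤ n * (1 - α)` samples lie strictly above `-b`, so at least `n * α` are
      -- clipped there.
      · have hlt := card_orderStat_lt_lt (y := y) hm1 hmn
        rw [h] at hlt
        have hlt' : ((Finset.univ.filter fun j => -b < y j).card : ℝ) ≤ m := by
          exact_mod_cast hlt.le
        have hadd : (∑ j, (Set.Iic (-b)).indicator (fun _ => (1 : ℝ)) (x j)) +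
            (Finset.univ.filter fun j => -b < y j).card = n := by
          rw [← Finset.sum_boole, ← Finset.sum_add_distrib]
          calc _ = ∑ _j : Fin n, (1 : ℝ) := Finset.sum_congr rfl fun j _ => by
                simp only [Set.indicator_apply, Set.mem_Iic, y, ← clip_le_neg_iff (x := x j) hb,
                  ← not_le]
                split_ifs <;> simp
            _ = n := by simp
        change n * α ≤ ∑ j, (Set.Iic (-b)).indicator (fun _ => (1 : ℝ)) (x j)
        linarith
      · have hall : tailSum y (-b) = ∑ j, clip b (x j) :=
          Finset.sum_congr rfl fun j _ => if_pos (abs_le.1 (abs_clip_le hb.le _)).1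
        rw [h, hall] at hω
        change ∑ j, clip b (x j) ≤ _
        linarith
  calc _ ≤ _ := ENNReal.toReal_mono (measure_ne_top _ _) (measure_mono_ae hsub)
    _ ≤ _ := measureReal_union_le _ _
    _ ≤ _ := add_le_add_left (measureReal_union_le _ _) _
    _ ≤ _ := by linarith

end Tail

/-! ### Error probability of a single arm -/

lemma lt_rpow_of_rpow_one_div_lt {x y z : ℝ} (hx : 0 ≤ x) (hy : 0 ≤ y) (hz : 0 < z)
    (h : x ^ (1 / z) < y) : x < y ^ z := by
  rw [one_div] at h
  exact (Real.rpow_inv_lt_iff_of_pos hx hy hz).1 h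

/-- Passes from the real ratio `s = T/K` to its floor `n`; this is where the `n + 1` in the
exponents comes from. -/
lemma rpow_one_sub_le_div {n s a : ℝ} (hn : 0 < n) (hs : 0 ≤ s) (hsn : s ≤ n + 1) (ha : 0 ≤ a)
    (ha1 : a ≤ 1) : s ^ (1 - a) ≤ (n + 1) / n ^ a := by
  calc s ^ (1 - a) ≤ (n + 1) ^ (1 - a) := Real.rpow_le_rpow hs hsn (by linarith)
    _ = (n + 1) / (n + 1) ^ a := by rw [Real.rpow_sub (by linarith), Real.rpow_one]
    _ ≤ (n + 1) / n ^ a := by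
        have := Real.rpow_pos_of_pos hn a
        gcongr
        linarith

/-- Makes the CVaR bound trivial when `Q < 20`, since then `(Q + 1) / 12 < 7/4`. The proof compares
`e⁷` with `6⁴`. -/
lemma one_le_six_mul_exp : 1 ≤ 6 * Real.exp (-(7 / 4)) := by
  have h1 : Real.exp (7 / 4) ≤ 6 := by
    refine le_of_pow_le_pow_left₀ (n := 4) (by norm_num) (by norm_num) ?_
    rw [← Real.exp_nat_mul, show ((4 : ℕ) : ℝ) * (7 / 4) = ((7 : ℕ) : ℝ) * 1 by norm_num,
      Real.exp_nat_mul]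
    calc Real.exp 1 ^ 7 ≤ 2.7182818286 ^ 7 :=
          pow_le_pow_left₀ (Real.exp_pos _).le Real.exp_one_lt_d9.le 7
      _ ≤ 6 ^ 4 := by norm_num
  rw [Real.exp_neg, ← div_eq_mul_inv, one_le_div (Real.exp_pos _)]
  exact h1

lemma three_mul_exp_le {Q : ℝ} : 3 * Real.exp (-(Q / 12)) ≤ 6 * Real.exp (-((Q + 1) / 12)) := by
  have h : -((Q + 1) / 12) = -(Q / 12) + -(1 / 12) := by ring
  have h1 := Real.add_one_le_exp (-(1 / 12 : ℝ))
  rw [h, Real.exp_add]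
  nlinarith [Real.exp_pos (-(Q / 12))]

section Arm

variable {Ω : Type*} [MeasurableSpace Ω] {μ : Measure Ω} [IsProbabilityMeasure μ]
  {ν : Measure ℝ} [IsProbabilityMeasure ν] {X : ℕ → Ω → ℝ}
  {ξ₁ ξ₂ α qm qc p B Δ s : ℝ} {n : ℕ}

/-- Both tails of the truncated mean, in terms of the gap. -/
lemma truncMean_tails (hlaw : ∀ j, HasLaw (X j) ν μ) (hind : iIndepFun X μ)
    (hξ₁ : 0 < ξ₁) (hqm : qm ∈ Set.Ioo (0 : ℝ) 1) (hp : 1 < p) (hB : 2 < p → 1 ≤ B)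
    (hC2 : CondC2 p B ν) (hΔ : 0 < Δ) (hn : 1 ≤ n)
    (hlt : (12 * ξ₁ * B / Δ) ^ (1 / (qm * min (p - 1) 1)) < n) (hs : 0 ≤ s) (hsn : s ≤ n + 1) :
    μ.real {ω | (∫ x, x ∂ν) + Δ / (4 * ξ₁) ≤ truncMean ((n : ℝ) ^ qm) fun j : Fin n => X j ω} ≤
        2 * Real.exp (-(s ^ (1 - qm) * (Δ / (16 * ξ₁)))) ∧
      μ.real {ω | (truncMean ((n : ℝ) ^ qm) fun j : Fin n => X j ω) ≤
          (∫ x, x ∂ν) - Δ / (4 * ξ₁)} ≤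
        2 * Real.exp (-(s ^ (1 - qm) * (Δ / (16 * ξ₁)))) := by
  have hn' : (1 : ℝ) ≤ n := by exact_mod_cast hn
  have hM0 : 0 ≤ ∫ x, |x| ^ p ∂ν := integral_nonneg fun x => by positivity
  have hB0 : 0 < B := hM0.trans_lt hC2.2
  have hmin : 0 < min (p - 1) 1 := lt_min (by linarith) one_pos
  have hb : 1 ≤ (n : ℝ) ^ qm := Real.one_le_rpow hn' hqm.1.le
  have h12 := lt_rpow_of_rpow_one_div_lt (by positivity) (by linarith) (mul_pos hqm.1 hmin) hlt
  rw [Real.rpow_mul (by linarith)] at h12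
  have hexp := rpow_one_sub_le_div (n := n) (by linarith) hs hsn hqm.1.le hqm.2.le
  set b := (n : ℝ) ^ qm
  have hb0 : 0 < b := by linarith
  -- One third of the allowed deviation `Δ / (4 * ξ₁)`.
  set D := Δ / (12 * ξ₁) with hDdef
  have hD : 0 < D := by positivity
  have hbm : 0 < b ^ min (p - 1) 1 := Real.rpow_pos_of_pos hb0 _
  -- The first term of `nStar`; it yields both the bias bound and the second-moment bound.
  have hBD : B ≤ D * b ^ min (p - 1) 1 := by
    rw [div_lt_iff₀ hΔ] at h12
    rw [hDdef, div_mul_eq_mul_div, le_div_iff₀ (by positivity)]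
    linarith
  have hbias : |(∫ x, x ∂ν) - ∫ x, (if |x| ≤ b then x else 0) ∂ν| ≤ D := by
    refine (abs_integral_sub_integral_truncate_le hp hb0 hC2.1).trans ?_
    rw [div_le_iff₀ (Real.rpow_pos_of_pos hb0 _)]
    calc _ ≤ B := hC2.2.le
      _ ≤ _ := hBD
      _ ≤ _ := by
        gcongr
        exact min_le_left _ _
  have hV : ∫ x, (if |x| ≤ b then x else 0) ^ 2 ∂ν ≤ b * D := by
    refine (integral_truncate_sq_le hp hb0 hC2 hB).trans ?_
    rw [Real.rpow_sub hb0, Real.rpow_one, mul_div_assoc', div_le_iff₀ hbm]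
    nlinarith
  have h3 : 3 * D = Δ / (4 * ξ₁) := by
    rw [hDdef]
    field_simp
    norm_num
  have hfin : 2 * Real.exp (-(3 / 4 * (n + 1) * D / b)) ≤
      2 * Real.exp (-(s ^ (1 - qm) * (Δ / (16 * ξ₁)))) := by
    gcongr
    calc s ^ (1 - qm) * (Δ / (16 * ξ₁)) ≤ (n + 1) / b * (Δ / (16 * ξ₁)) := by gcongr
      _ = 3 / 4 * (n + 1) * D / b := by
        rw [hDdef]
        field_simp
        norm_num
  rw [← h3]
  exact ⟨(measureReal_truncMean_ge_le hlaw hind hb0 hD.le hbias hV hn).trans hfin,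
    (measureReal_truncMean_le_le hlaw hind hb0 hD.le hbias hV hn).trans hfin⟩

/-- Both tails of the clipped CVaR estimator, in terms of the gap. -/
lemma clippedCVaR_tails (hlaw : ∀ j, HasLaw (X j) ν μ) (hind : iIndepFun X μ)
    (hξ₂ : 0 < ξ₂) (hα : α ∈ Set.Ioo (0 : ℝ) 1) (hqc : qc ∈ Set.Ioo (0 : ℝ) (1 / 2)) (hp : 1 < p)
    (hc : Continuous (cdf ν)) (hC2 : CondC2 p B ν) (hΔ : 0 < Δ) (hn : 1 ≤ n)
    (hlt1 : (8 * ξ₂ * B / ((1 - α) * Δ)) ^ (1 / (qc * (p - 1))) < n)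
    (hlt2 : (B / min α (1 - α)) ^ (1 / (qc * p)) < n)
    (hlt3 : (Δ / (8 * ξ₂)) ^ (1 / qc) < n) (hs : 0 ≤ s) (hsn : s ≤ n + 1) :
    μ.real {ω | cvar α ν + Δ / (4 * ξ₂) ≤ clippedCVaR α ((n : ℝ) ^ qc) fun j : Fin n => X j ω} ≤
        6 * Real.exp (-(s ^ (1 - 2 * qc) * ((1 - α) * Δ ^ 2 / (768 * ξ₂ ^ 2)))) ∧
      μ.real {ω | (clippedCVaR α ((n : ℝ) ^ qc) fun j : Fin n => X j ω) ≤
          cvar α ν - Δ / (4 * ξ₂)} ≤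
        6 * Real.exp (-(s ^ (1 - 2 * qc) * ((1 - α) * Δ ^ 2 / (768 * ξ₂ ^ 2)))) := by
  have hn' : (1 : ℝ) ≤ n := by exact_mod_cast hn
  have hn0 : (0 : ℝ) ≤ n := by linarith
  have hβ : 0 < 1 - α := by linarith [hα.2]
  have hM0 : 0 ≤ ∫ x, |x| ^ p ∂ν := integral_nonneg fun x => by positivity
  have hB0 : 0 < B := hM0.trans_lt hC2.2
  have hmin : 0 < min α (1 - α) := lt_min hα.1 hβ
  have hqc0 := hqc.1
  have hg1 := lt_rpow_of_rpow_one_div_lt (by positivity) hn0 (mul_pos hqc0 (sub_pos.2 hp)) hlt1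
  have hg2 := lt_rpow_of_rpow_one_div_lt (by positivity) hn0
    (mul_pos hqc0 (by linarith : 0 < p)) hlt2
  have hg3 := lt_rpow_of_rpow_one_div_lt (by positivity) hn0 hqc0 hlt3
  rw [Real.rpow_mul hn0] at hg1 hg2
  have hexp := rpow_one_sub_le_div (n := n) (by linarith) hs hsn
    (show 0 ≤ 2 * qc by linarith) (by linarith [hqc.2])
  rw [mul_comm 2 qc, Real.rpow_mul hn0, Real.rpow_two, mul_comm qc 2] at hexp
  have hb0 : 0 < (n : ℝ) ^ qc := Real.rpow_pos_of_pos (by linarith) _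
  set b := (n : ℝ) ^ qc
  -- Chosen so that `2 * θ * b` is the allowed deviation `Δ / (4 * ξ₂)`. The fourth term of `nStar`
  -- gives `θ ≤ 1`.
  set θ := Δ / (8 * ξ₂ * b) with hθdef
  have hθ : 0 < θ := by positivity
  have hθb : 8 * ξ₂ * (θ * b) = Δ := by
    rw [hθdef]
    field_simp
  have hθ1 : θ ≤ 1 := by
    rw [hθdef, div_le_one (by positivity)]
    rw [div_lt_iff₀ (by positivity)] at hg3
    linarith
  have hx : s ^ (1 - 2 * qc) * ((1 - α) * Δ ^ 2 / (768 * ξ₂ ^ 2)) ≤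
      (n * (1 - α) * θ ^ 2 + 1) / 12 := by
    calc _ ≤ (n + 1) / b ^ 2 * ((1 - α) * Δ ^ 2 / (768 * ξ₂ ^ 2)) := by gcongr
      _ = (n * (1 - α) * θ ^ 2 + (1 - α) * θ ^ 2) / 12 := by
          rw [← hθb]
          field_simp
          ring
      _ ≤ _ := by
          have hθ2 : θ ^ 2 ≤ 1 := pow_le_one₀ hθ.le hθ1
          have : (1 - α) * θ ^ 2 ≤ 1 := by nlinarith [hα.1]
          linarith
  rcases le_or_gt 20 (n * (1 - α) * θ ^ 2) with hQ | hQ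
  · have hfin : 3 * Real.exp (-(n * (1 - α) * θ ^ 2 / 12)) ≤
        6 * Real.exp (-(s ^ (1 - 2 * qc) * ((1 - α) * Δ ^ 2 / (768 * ξ₂ ^ 2)))) :=
      three_mul_exp_le.trans (by gcongr)
    have hi := integrable_id_of_rpow hp hC2.1
    have hbp : 0 < b ^ p := Real.rpow_pos_of_pos hb0 _
    have hbp1 : 0 < b ^ (p - 1) := Real.rpow_pos_of_pos hb0 _
    -- By Markov, the third term of `nStar` puts the value at risk strictly inside `(-b, b)`, where
    -- clipping leaves it unchanged.
    have hrare : (∫ x, |x| ^ p ∂ν) / b ^ p < min α (1 - α) := by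
      rw [div_lt_iff₀ hbp]
      rw [div_lt_iff₀ hmin] at hg2
      linarith [hC2.2]
    have h1 : -b < valueAtRisk α ν := neg_lt_valueAtRisk hc hα <|
      (measureReal_mul_rpow_le hp hb0 hC2.1 measurableSet_Iic fun x hx =>
        (le_neg_of_le_neg hx).trans (neg_le_abs x)).trans_lt (hrare.trans_le (min_le_left _ _))
    have h2 : valueAtRisk α ν < b := valueAtRisk_lt hc hα <|
      (measureReal_mul_rpow_le hp hb0 hC2.1 measurableSet_Ici fun x hx =>
        (Set.mem_Ici.1 hx).trans (le_abs_self x)).trans_lt (hrare.trans_le (min_le_right _ _))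
    -- The second term of `nStar`.
    have hbias : (∫ x, max 0 (x - b) ∂ν) + b * ν.real (Set.Iic (-b)) ≤ (1 - α) * θ * b := by
      refine (integral_excess_add_le hp hb0 hC2.1).trans ?_
      rw [div_le_iff₀ hbp1]
      rw [div_lt_iff₀ (by positivity), ← hθb] at hg1
      have : 8 * ξ₂ * B ≤ 8 * ξ₂ * ((1 - α) * θ * b * b ^ (p - 1)) := by linarith
      exact hC2.2.le.trans (le_of_mul_le_mul_left this (by positivity))
    have h2θ : Δ / (4 * ξ₂) = 2 * θ * b := by
      rw [← hθb]
      field_simp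
      norm_num
    rw [h2θ]
    have he := Real.exp_pos (-(n * (1 - α) * θ ^ 2 / 12))
    exact ⟨(measureReal_clippedCVaR_ge_le hlaw hind hc hα hi h1 h2 hθ hθ1 hQ).trans
      (by linarith),
      (measureReal_clippedCVaR_le_le hlaw hind hc hα hi h1 h2 hθ hθ1 hbias hQ).trans hfin⟩
  · have hfin : 1 ≤ 6 * Real.exp (-(s ^ (1 - 2 * qc) * ((1 - α) * Δ ^ 2 / (768 * ξ₂ ^ 2)))) := by
      refine one_le_six_mul_exp.trans ?_
      gcongr
      linarith
    exact ⟨measureReal_le_one.trans hfin, measureReal_le_one.trans hfin⟩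

/-- Both tails of the estimate of an arm. -/
lemma armEstimate_tails (hlaw : ∀ j, HasLaw (X j) ν μ) (hind : iIndepFun X μ)
    (hξ₁ : 0 < ξ₁) (hξ₂ : 0 < ξ₂) (hα : α ∈ Set.Ioo (0 : ℝ) 1) (hqm : qm ∈ Set.Ioo (0 : ℝ) 1)
    (hqc : qc ∈ Set.Ioo (0 : ℝ) (1 / 2)) (hp : 1 < p) (hB : 2 < p → 1 ≤ B)
    (hc : Continuous (cdf ν)) (hC2 : CondC2 p B ν) (hΔ : 0 < Δ)
    (hlt : nStar ξ₁ ξ₂ α qm qc p B Δ < n) (hs : 0 ≤ s) (hsn : s ≤ n + 1) :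
    μ.real {ω | objective ξ₁ ξ₂ α ν + Δ / 2 ≤ armEstimate ξ₁ ξ₂ α qm qc (fun j => X j ω) n} ≤
        2 * Real.exp (-(s ^ (1 - qm) * (Δ / (16 * ξ₁)))) +
          6 * Real.exp (-(s ^ (1 - 2 * qc) * ((1 - α) * Δ ^ 2 / (768 * ξ₂ ^ 2)))) ∧
      μ.real {ω | armEstimate ξ₁ ξ₂ α qm qc (fun j => X j ω) n ≤ objective ξ₁ ξ₂ α ν - Δ / 2} ≤
        2 * Real.exp (-(s ^ (1 - qm) * (Δ / (16 * ξ₁)))) +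
          6 * Real.exp (-(s ^ (1 - 2 * qc) * ((1 - α) * Δ ^ 2 / (768 * ξ₂ ^ 2)))) := by
  simp only [nStar, max_lt_iff] at hlt
  obtain ⟨⟨hl1, hl2⟩, hl3, hl4⟩ := hlt
  have hn : 1 ≤ n := by
    have h0 : (0 : ℝ) ≤ (Δ / (8 * ξ₂)) ^ (1 / qc) := by positivity
    exact_mod_cast h0.trans_lt hl4
  obtain ⟨hm1, hm2⟩ := truncMean_tails hlaw hind hξ₁ hqm hp hB hC2 hΔ hn hl1 hs hsn
  obtain ⟨hc1, hc2⟩ := clippedCVaR_tails hlaw hind hξ₂ hα hqc hp hc hC2 hΔ hn hl2 hl3 hl4 hs hsn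
  have e1 : ξ₁ * (Δ / (4 * ξ₁)) = Δ / 4 := by
    field_simp
  have e2 : ξ₂ * (Δ / (4 * ξ₂)) = Δ / 4 := by
    field_simp
  refine ⟨(measureReal_mono fun ω hω => ?_).trans
      ((measureReal_union_le _ _).trans (add_le_add hm1 hc1)),
    (measureReal_mono fun ω hω => ?_).trans
      ((measureReal_union_le _ _).trans (add_le_add hm2 hc2))⟩
  · by_contra hcon
    simp only [Set.mem_union, Set.mem_ofPred_eq, not_or, not_le] at hcon hω
    have h1 := mul_lt_mul_of_pos_left hcon.1 hξ₁
    have h2 := mul_lt_mul_of_pos_left hcon.2 hξ₂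
    rw [armEstimate, objective] at hω
    linarith
  · by_contra hcon
    simp only [Set.mem_union, Set.mem_ofPred_eq, not_or, not_le] at hcon hω
    have h1 := mul_lt_mul_of_pos_left hcon.1 hξ₁
    have h2 := mul_lt_mul_of_pos_left hcon.2 hξ₂
    rw [armEstimate, objective] at hω
    linarith

end Arm

/-! ### The gap -/

lemma minGap_le {K : ℕ} (ξ₁ ξ₂ α : ℝ) (ν : Fin K → Measure ℝ) {iStar i : Fin K} (hi : i ≠ iStar) :
    minGap ξ₁ ξ₂ α ν iStar ≤ objective ξ₁ ξ₂ α (ν i) - objective ξ₁ ξ₂ α (ν iStar) :=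
  ciInf_le (Set.finite_range _).bddBelow (⟨i, hi⟩ : {i : Fin K // i ≠ iStar})

lemma minGap_pos {K : ℕ} (hK : 2 ≤ K) {ξ₁ ξ₂ α : ℝ} {ν : Fin K → Measure ℝ} {iStar : Fin K}
    (hopt : ∀ i, i ≠ iStar → objective ξ₁ ξ₂ α (ν iStar) < objective ξ₁ ξ₂ α (ν i)) :
    0 < minGap ξ₁ ξ₂ α ν iStar := by
  have : Nontrivial (Fin K) := Fin.nontrivial_iff_two_le.2 hK
  obtain ⟨i, hi⟩ := exists_ne iStar
  have : Nonempty {i : Fin K // i ≠ iStar} := ⟨⟨i, hi⟩⟩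
  obtain ⟨j, hj⟩ := exists_eq_ciInf_of_finite
    (f := fun i : {i : Fin K // i ≠ iStar} =>
      objective ξ₁ ξ₂ α (ν i) - objective ξ₁ ξ₂ α (ν iStar))
  rw [minGap, ← hj]
  exact sub_pos.2 (hopt j j.2)

end RiskBandit

theorem theorem3
    {Ω : Type*} [MeasurableSpace Ω] (μ : Measure Ω) [IsProbabilityMeasure μ]
    (K : ℕ) (hK : 2 ≤ K)
    (ξ₁ ξ₂ α qm qc p B : ℝ)
    (hξ₁ : 0 < ξ₁) (hξ₂ : 0 < ξ₂)
    (hα : α ∈ Set.Ioo (0 : ℝ) 1)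
    (hqm : qm ∈ Set.Ioo (0 : ℝ) 1) (hqc : qc ∈ Set.Ioo (0 : ℝ) (1 / 2))
    (hp : 1 < p) (hB : 2 < p → 1 ≤ B)
    -- the laws of the arms
    (ν : Fin K → Measure ℝ) (hν : ∀ i, IsProbabilityMeasure (ν i))
    (hC1 : ∀ i, RiskBandit.CondC1 (ν i))
    (hC2 : ∀ i, RiskBandit.CondC2 p B (ν i))
    -- `iStar` is the unique optimal arm
    (iStar : Fin K)
    (hopt : ∀ i, i ≠ iStar →
      RiskBandit.objective ξ₁ ξ₂ α (ν iStar) < RiskBandit.objective ξ₁ ξ₂ α (ν i))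
    -- `X i j` is the loss observed at the `(j+1)`-st pull of arm `i`
    (X : Fin K → ℕ → Ω → ℝ)
    (hlaw : ∀ i j, HasLaw (X i j) (ν i) μ)
    (hindep : iIndepFun (fun q : Fin K × ℕ => X q.1 q.2) μ)
    -- the budget, and the arm selected by uniform exploration
    (T : ℕ)
    (hT : RiskBandit.nStar ξ₁ ξ₂ α qm qc p B
      (RiskBandit.minGap ξ₁ ξ₂ α ν iStar) < ((T / K : ℕ) : ℝ))
    (out : Ω → Fin K)
    (hout : ∀ ω, RiskBandit.IsUniformExplorationOutput T
      (fun i n => RiskBandit.armEstimate ξ₁ ξ₂ α qm qc (fun j => X i j ω) n) (out ω)) :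
    μ.real {ω | out ω ≠ iStar} ≤
      2 * (K : ℝ) * Real.exp (-(((T : ℝ) / K) ^ (1 - qm) *
        (RiskBandit.minGap ξ₁ ξ₂ α ν iStar / (16 * ξ₁)))) +
      6 * (K : ℝ) * Real.exp (-(((T : ℝ) / K) ^ (1 - 2 * qc) *
        ((1 - α) * RiskBandit.minGap ξ₁ ξ₂ α ν iStar ^ 2 / (768 * ξ₂ ^ 2)))) := by
  set Δ := RiskBandit.minGap ξ₁ ξ₂ α ν iStar
  have hΔ : 0 < Δ := RiskBandit.minGap_pos hK hopt
  have hs : (0 : ℝ) ≤ (T : ℝ) / K := by positivity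
  have hsn : (T : ℝ) / K ≤ (T / K : ℕ) + 1 := by
    have hK0 : (0 : ℝ) < K := by exact_mod_cast (by omega : 0 < K)
    rw [div_le_iff₀ hK0]
    exact_mod_cast ((Nat.div_lt_iff_lt_mul (by omega : 0 < K)).1 (Nat.lt_succ_self (T / K))).le
  have htails := fun i => RiskBandit.armEstimate_tails (hlaw i)
    (hindep.precomp (g := fun j => (i, j)) (Prod.mk_right_injective i)) hξ₁ hξ₂ hα hqm hqc hp hB
    (hC1 i).1 (hC2 i) hΔ hT hs hsn
  set G := 2 * Real.exp (-(((T : ℝ) / K) ^ (1 - qm) * (Δ / (16 * ξ₁)))) +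
    6 * Real.exp (-(((T : ℝ) / K) ^ (1 - 2 * qc) * ((1 - α) * Δ ^ 2 / (768 * ξ₂ ^ 2))))
  set est : Fin K → Ω → ℝ := fun i ω =>
    RiskBandit.armEstimate ξ₁ ξ₂ α qm qc (fun j => X i j ω) (T / K)
  -- Only the upper tail matters for `iStar` and only the lower tail for the other arms, so the
  -- union has `K` events rather than `2 * K`.
  set bad : Fin K → Set Ω := fun i =>
    if i = iStar then {ω | RiskBandit.objective ξ₁ ξ₂ α (ν i) + Δ / 2 ≤ est i ω}
    else {ω | est i ω ≤ RiskBandit.objective ξ₁ ξ₂ α (ν i) - Δ / 2}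
  have hbad : ∀ i, μ.real (bad i) ≤ G := fun i => by
    simp only [bad]
    split_ifs
    · exact (htails i).1
    · exact (htails i).2
  have hsub : {ω | out ω ≠ iStar} ⊆ ⋃ i, bad i := by
    intro ω hω
    have hne : out ω ≠ iStar := hω
    have hle : est (out ω) ω ≤ est iStar ω := (hout ω).le iStar
    have hgap := RiskBandit.minGap_le ξ₁ ξ₂ α ν hne
    rw [Set.mem_iUnion]
    by_contra! hcon
    have h1 := hcon iStar
    have h2 := hcon (out ω)
    simp only [bad, if_pos, if_neg hne, Set.mem_ofPred_eq, not_le] at h1 h2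
    linarith
  calc μ.real {ω | out ω ≠ iStar} ≤ μ.real (⋃ i, bad i) := measureReal_mono hsub
    _ ≤ ∑ i, μ.real (bad i) := measureReal_iUnion_fintype_le _
    _ ≤ ∑ _i : Fin K, G := Finset.sum_le_sum fun i _ => hbad i
    _ = _ := by
      rw [Finset.sum_const, Finset.card_univ, Fintype.card_fin, nsmul_eq_mul]
      ring
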